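/- **Setting.** Let $\rho$ be a compactly supported probability measure on $[0,\infty)$ with unit first moment (the asymptotic eigenvalue distribution of $\boldsymbol A^{\mathrm T}\boldsymbol A$ for the sensing matrix $\boldsymbol A$), let $\sigma^2>0$ be the noise variance, and let $x_1$ be a real random variable (a signal element) with $\mathbb E[x_1]=0$ and $\mathbb E[x_1^2]=1$. The $\eta$-transform of $\rho$ is $\eta(x)=\int(1+x\lambda)^{-1}\,d\rho(\lambda)$. Its R-transform is $R(x)=S^{-1}(-x)-1/x$, where $S(s)=\int(\lambda-s)^{-1}d\rho(\lambda)$ on the real $s$ lying below, or above, the whole support of $\rho$ (where $S$ is injective). For $v>0$ let $f_{\mathrm{opt}}(u;v)=\mathbb E[x_1\mid x_1+z=u]$ with $z\sim\mathcal N(0,v)$ independent of $x_1$, and let $f_{\mathrm{opt}}(u;0)=u$. Let $\{g_\tau\},\{\theta_\tau\}$ be real tap coefficients with $g_0=\theta_0=1$, with generating functions $G(z)=\sum_\tau g_\tau z^{-\tau}$, $\Theta(z)=\sum_\tau\theta_\tau z^{-\tau}$. Write $G=P/Q$ with $P(z)=\sum_\tau p_\tau z^{-\tau}$, $Q(z)=\sum_\tau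 q_\tau z^{-\tau}$, $p_0=q_0=1$ (as power series in $z^{-1}$; $P=G$, $Q=1$ is allowed), and put $r_t=q_t*\theta_t$. For sequences, $u_{t+i}*v_{t+j}=\sum_{\tau=0}^{t}u_{\tau+i}v_{t-\tau+j}$; in expressions with two indices $\tau',\tau$ the convolution runs over $\tau$ if one operand depends on $\tau$ only, and over both indices if both operands depend on both. Entries with negative index are zero. **State evolution (SE).** Arrays $\{a_{t',t}\},\{d_{t',t}\}_{t',t\ge0}$ solve the time-domain SE of CAMP with Bayes-optimal denoisers $f_t=f_{\mathrm{opt}}(\cdot;a_{t,t})$ if there is a zero-mean Gaussian process $\{z_t\}$, independent of $x_1$, with $\mathbb E[z_{t'}z_t]=a_{t',t}$, such that $d_{0,0}=1$, $$d_{0,t+1}=d_{t+1,0}=-\mathbb E[x_1\{f_t(x_1+z_t)-x_1\}],\qquad d_{t'+1,t+1}=\mathbb E[\{f_{t'}(x_1+z_{t'})-x_1\}\{f_t(x_1+z_t)-x_1\}],$$ and, with $\bar\xi_t=\mathbb E[f_t'(x_1+z_t)]$ and $\bar\xi_{\tau}^{(t-1)}=\prod_{k=\tau}^{t-1}\bar\xi_k$,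 for all $t',t\ge0$, $$\sum_{\tau'=0}^{t'}\sum_{\tau=0}^{t}\bar\xi_{t'-\tau'}^{(t'-1)}\bar\xi_{t-\tau}^{(t-1)}\Big\{\mathfrak D_{\tau',\tau}a_{t'-\tau',t-\tau}-(p_\tau*r_{\tau'+\tau+1}-r_\tau*p_{\tau'+\tau+1})d_{t'-\tau',t-\tau}-\sigma^2[(q_{\tau'}q_\tau)*(\theta_{\tau'+\tau}-\theta_{\tau'+\tau+1})]\Big\}=0,$$ $$\begin{aligned}\mathfrak D_{\tau',\tau}={}&(p_{\tau'+\tau}-p_{\tau'+\tau+1})*q_\tau+(p_\tau-p_{\tau-1})*q_{\tau'+\tau+1}+(p_{\tau-1}-p_\tau)*r_{\tau'+\tau+1}+(r_\tau-r_{\tau-1})*p_{\tau'+\tau+1}\\&+p_\tau*(r_{\tau'+\tau}-\delta_{\tau',0}r_\tau)-r_\tau*(p_{\tau'+\tau}-\delta_{\tau',0}p_\tau).\end{aligned}$$ **Theorem.** Let $\{a_{t',t},d_{t',t}\}$ solve this SE and converge to a fixed point: $\lim_{t',t\to\infty}a_{t',t}=a_{\mathrm s}>0$ and $\lim_{t',t\to\infty}d_{t',t}=d_{\mathrm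 s}$. Put $\xi_{\mathrm s}=d_{\mathrm s}/a_{\mathrm s}$. Suppose that the power series $P,Q,\Theta$ in $z^{-1}$ have radius of convergence larger than $\xi_{\mathrm s}$, that $Q(\xi_{\mathrm s}^{-1})\ne0$, and that the tap coefficients satisfy $$\eta\left(\frac{1-(1-z^{-1})\Theta(z)}{(1-z^{-1})G(z)}\right)=(1-z^{-1})\Theta(z)$$ for all real $z^{-1}\in[0,\xi_{\mathrm s}]$ at which the left-hand side is defined, where $G(z)=P(z)/Q(z)$. If $$\Theta(\xi_{\mathrm s}^{-1})=1\qquad\text{and}\qquad 1+(\xi_{\mathrm s}-1)\frac{d\Theta}{dz^{-1}}(\xi_{\mathrm s}^{-1})\ne0,$$ then $-d_{\mathrm s}/\sigma^2$ lies in the domain of $R$ and $$a_{\mathrm s}=\frac{\sigma^2}{R(-d_{\mathrm s}/\sigma^2)},\qquad d_{\mathrm s}=\mathbb E\left[\{f_{\mathrm{opt}}(x_1+z_{\mathrm s};a_{\mathrm s})-x_1\}^2\right],$$ with $z_{\mathrm s}\sim\mathcal N(0,a_{\mathrm s})$ independent of $x_1$. -/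

import Mathlib

open MeasureTheory ProbabilityTheory Filter Topology

noncomputable section

namespace CAMP

/-! ### Sequences and their generating functions -/

/-- The generating function `S(z) = ∑ₜ sₜ z⁻ᵗ`, written in the variable `w = z⁻¹`. -/
def gen (s : ℕ → ℝ) (w : ℝ) : ℝ := ∑' t, s t * w ^ t

/-- The power series with coefficients `s` has radius of convergence larger than `w`. -/
def ConvergesBeyond (s : ℕ → ℝ) (w : ℝ) : Prop :=
  ∃ r, w < r ∧ Summable fun t => |s t| * r ^ t

/-- One-dimensional convolution `uₜ * vₜ = ∑_{τ ≤ t} u_τ v_{t-τ}`. -/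
def conv (u v : ℕ → ℝ) (t : ℕ) : ℝ := ∑ s ∈ Finset.range (t + 1), u s * v (t - s)

/-- The delayed sequence `u_{t-1}`, with the convention `u_{-1} = 0`. -/
def delay (u : ℕ → ℝ) (t : ℕ) : ℝ := if t = 0 then 0 else u (t - 1)

/-! ### Transforms of the asymptotic eigenvalue distribution -/

/-- The `η`-transform `η(x) = ∫ (1 + xλ)⁻¹ dρ(λ)`. -/
def etaTransform (ρ : Measure ℝ) (x : ℝ) : ℝ := ∫ l, 1 / (1 + x * l) ∂ρ

/-- The Stieltjes transform `S(s) = ∫ (λ - s)⁻¹ dρ(λ)`. -/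
def stieltjes (ρ : Measure ℝ) (s : ℝ) : ℝ := ∫ l, 1 / (l - s) ∂ρ

/-- The real points on either side of the support of `ρ`. The Stieltjes transform of a compactly
supported probability measure is injective there. -/
def outside (ρ : Measure ℝ) : Set ℝ :=
  {s | (∀ l ∈ ρ.support, s < l) ∨ (∀ l ∈ ρ.support, l < s)}

/-- The nonzero reals at which `R(x) = S⁻¹(-x) - 1/x` is defined. -/
def rDomain (ρ : Measure ℝ) : Set ℝ := {x | -x ∈ stieltjes ρ '' outside ρ}

/-- The R-transform `R(x) = S⁻¹(-x) - 1/x`, with `R(0)` the mean of `ρ`. -/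
def rTransform (ρ : Measure ℝ) (x : ℝ) : ℝ :=
  if x = 0 then ∫ l, l ∂ρ
  else Function.invFunOn (stieltjes ρ) (outside ρ) (-x) - 1 / x

/-- The argument `x = (1 - (1 - z⁻¹)Θ(z)) / ((1 - z⁻¹)G(z))` of the `η`-transform, at `w = z⁻¹`,
where `G = P/Q`. -/
def tapArg (p q θ : ℕ → ℝ) (w : ℝ) : ℝ :=
  (1 - (1 - w) * gen θ w) / ((1 - w) * (gen p w / gen q w))

/-- The equation `η((1 - (1 - z⁻¹)Θ(z)) / ((1 - z⁻¹)G(z))) = (1 - z⁻¹)Θ(z)` with `G = P/Q`,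
for all real `w = z⁻¹` in `[0, w₀]` at which the left-hand side is defined. -/
def ClosedForm (ρ : Measure ℝ) (p q θ : ℕ → ℝ) (w₀ : ℝ) : Prop :=
  ∀ w ∈ Set.Icc 0 w₀, gen q w ≠ 0 → (1 - w) * (gen p w / gen q w) ≠ 0 →
    (∀ l ∈ ρ.support, 1 + tapArg p q θ w * l ≠ 0) →
    etaTransform ρ (tapArg p q θ w) = (1 - w) * gen θ w

/-! ### The Bayes-optimal denoiser -/

/-- `f_opt(u; v) = E[x | x + z = u]` for `x ∼ π` and independent `z ∼ N(0, v)`, by Bayes' formula.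
Without noise (`v = 0`) the observation is `x` itself. -/
def fOpt (π : Measure ℝ) (v u : ℝ) : ℝ :=
  if v = 0 then u
  else (∫ x, x * Real.exp (-(u - x) ^ 2 / (2 * v)) ∂π) /
    (∫ x, Real.exp (-(u - x) ^ 2 / (2 * v)) ∂π)

/-- `E[{f_opt(x + z; v) - x}²]` for independent `x ∼ π` and `z ∼ N(0, v)`. -/
def scalarMMSE (π : Measure ℝ) (v : ℝ) : ℝ :=
  ∫ xz : ℝ × ℝ, (fOpt π v (xz.1 + xz.2) - xz.1) ^ 2 ∂(π.prod (gaussianReal 0 v.toNNReal))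

/-! ### The state evolution equation in the time domain -/

/-- The array `𝔇_{τ',τ}` multiplying `a`, where `r = q * θ`. -/
def coeffA (p q θ : ℕ → ℝ) (τ' τ : ℕ) : ℝ :=
  let r := conv q θ
  conv (fun s => p (τ' + s) - p (τ' + s + 1)) q τ
    + conv (fun s => p s - delay p s) (fun s => q (τ' + s + 1)) τ
    + conv (fun s => delay p s - p s) (fun s => r (τ' + s + 1)) τ
    + conv (fun s => r s - delay r s) (fun s => p (τ' + s + 1)) τ
    + conv p (fun s => r (τ' + s) - if τ' = 0 then r s else 0) τ
    - conv r (fun s => p (τ' + s) - if τ' = 0 then p s else 0) τ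

/-- The array `p_τ * r_{τ'+τ+1} - r_τ * p_{τ'+τ+1}` multiplying `d`. -/
def coeffD (p q θ : ℕ → ℝ) (τ' τ : ℕ) : ℝ :=
  let r := conv q θ
  conv p (fun s => r (τ' + s + 1)) τ - conv r (fun s => p (τ' + s + 1)) τ

/-- The array `(q_{τ'} q_τ) * (θ_{τ'+τ} - θ_{τ'+τ+1})` multiplying `σ²`
(a two-dimensional convolution). -/
def coeffNoise (q θ : ℕ → ℝ) (τ' τ : ℕ) : ℝ :=
  ∑ s' ∈ Finset.range (τ' + 1), ∑ s ∈ Finset.range (τ + 1),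
    q s' * q s * (θ ((τ' - s') + (τ - s)) - θ ((τ' - s') + (τ - s) + 1))

/-- The state evolution equation at times `t', t`; the product over `[t - τ, t)` is
`ξ̄_{t-τ}^{(t-1)}`. -/
def SEEquation (σ : ℝ) (p q θ ξ : ℕ → ℝ) (a d : ℕ → ℕ → ℝ) (t' t : ℕ) : Prop :=
  ∑ τ' ∈ Finset.range (t' + 1), ∑ τ ∈ Finset.range (t + 1),
    (∏ k ∈ Finset.Ico (t' - τ') t', ξ k) * (∏ k ∈ Finset.Ico (t - τ) t, ξ k) *
      (coeffA p q θ τ' τ * a (t' - τ') (t - τ)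
        - coeffD p q θ τ' τ * d (t' - τ') (t - τ)
        - σ ^ 2 * coeffNoise q θ τ' τ) = 0

/-- The array pair `(a, d)` solves the time-domain state evolution of CAMP with the Bayes-optimal
denoisers `f_t = f_opt(·; a_{t,t})`, where `x₁` is a signal element and `z` is a zero-mean Gaussian
process with covariance `a`, independent of `x₁`. -/
structure IsBayesSE {Ω : Type*} [MeasurableSpace Ω] (P : Measure Ω) (x₁ : Ω → ℝ)
    (z : ℕ → Ω → ℝ) (σ : ℝ) (p q θ : ℕ → ℝ) (a d : ℕ → ℕ → ℝ) : Prop where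
  gaussian : IsGaussianProcess z P
  indep : IndepFun x₁ (fun ω t => z t ω) P
  mean_eq_zero : ∀ t, ∫ ω, z t ω ∂P = 0
  cov_eq : ∀ t' t, ∫ ω, z t' ω * z t ω ∂P = a t' t
  d_zero_zero : d 0 0 = 1
  d_zero_succ : ∀ t, d 0 (t + 1) =
    -∫ ω, x₁ ω * (fOpt (P.map x₁) (a t t) (x₁ ω + z t ω) - x₁ ω) ∂P
  d_succ_zero : ∀ t, d (t + 1) 0 = d 0 (t + 1)
  d_succ_succ : ∀ t' t, d (t' + 1) (t + 1) =
    ∫ ω, (fOpt (P.map x₁) (a t' t') (x₁ ω + z t' ω) - x₁ ω) *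
      (fOpt (P.map x₁) (a t t) (x₁ ω + z t ω) - x₁ ω) ∂P
  se : ∀ t' t, SEEquation σ p q θ
    (fun k => ∫ ω, deriv (fOpt (P.map x₁) (a k k)) (x₁ ω + z k ω) ∂P) a d t' t

end CAMP

end

namespace CAMP

/-! ### Power series in one variable -/

/-! Letting `t', t → ∞` turns the state evolution into one scalar equation. By `hasDerivAt_fOpt` the
slope of the posterior mean is the posterior variance over the noise variance, so the average slopes
tend to `ξₛ = dₛ / aₛ` (`integral_deriv_fOpt`, `tendsto_slope`). The products of slopes therefore
act as powers of `w = ξₛ`, and the double sums tend to the double generating functions of the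
coefficient arrays on the diagonal (`tendsto_discounted_sum`). These are expressions in `P, Q, Θ`
and their first derivatives at `w`, since an array in `τ' + τ` meets the power `w ^ n` exactly `n +
1` times.

The limit equation is `fixed_point`. Inserting `Θ = 1` and `dₛ = ξₛ aₛ`, it factors as `Q (1 + (ξₛ -
1) Θ') (aₛ P - σ² Q) = 0`, whence `G(ξₛ⁻¹) = σ² / aₛ`. The closed-form condition then reads `η(x) =
1 - ξₛ` with `x = dₛ / (σ² (1 - ξₛ))`, and `rTransform_of_etaTransform` converts it to `R(-dₛ/σ²) =
σ² / aₛ`. This needs `0 < ξₛ < 1`: the lower bound holds because the signal is not constant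
(`scalarMMSE_pos`), the upper one by comparison with the linear estimator (`scalarMMSE_le`). The
equation for `dₛ` is continuity of the mean square error in the noise variance. -/

lemma ConvergesBeyond.exists_between {s : ℕ → ℝ} {w : ℝ} (h : ConvergesBeyond s w) :
    ∃ R, w < R ∧ ∀ r, r < R → ConvergesBeyond s r := by
  obtain ⟨R, hR, hs⟩ := h
  exact ⟨R, hR, fun r hr => ⟨R, hr, hs⟩⟩

lemma ConvergesBeyond.summable {s : ℕ → ℝ} {w : ℝ} (h : ConvergesBeyond s w) (hw : 0 ≤ w) :
    Summable fun t => s t * w ^ t := by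
  obtain ⟨R, hR, hs⟩ := h
  refine hs.of_norm_bounded fun t => ?_
  rw [norm_mul, Real.norm_eq_abs, Real.norm_eq_abs, abs_of_nonneg (pow_nonneg hw t)]
  gcongr

lemma ConvergesBeyond.hasSum {s : ℕ → ℝ} {w : ℝ} (h : ConvergesBeyond s w) (hw : 0 ≤ w) :
    HasSum (fun t => s t * w ^ t) (gen s w) :=
  (h.summable hw).hasSum

lemma summable_derivative {s : ℕ → ℝ} {w : ℝ} (h : ConvergesBeyond s w) (hw : 0 ≤ w) :
    Summable fun t => |s t| * (t * w ^ (t - 1)) := by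
  obtain ⟨R, hR, hs⟩ := h
  have hR0 : 0 < R := hw.trans_lt hR
  have hlim : Tendsto (fun t : ℕ => (t : ℝ) * (w / R) ^ (t - 1)) atTop (𝓝 0) := by
    rw [← tendsto_add_atTop_iff_nat 1]
    have h1 : |w / R| < 1 := by
      rw [abs_of_nonneg (by positivity), div_lt_one hR0]; exact hR
    have e1 := tendsto_self_mul_const_pow_of_abs_lt_one h1
    have e2 := tendsto_pow_atTop_nhds_zero_of_abs_lt_one h1
    simpa [add_mul] using e1.add e2
  -- The threshold `R` supplies the missing power: it gives `t * w ^ (t - 1) ≤ R * R ^ (t - 1) = R ^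
  -- t`.
  have hev : ∀ᶠ t : ℕ in atTop, (t : ℝ) * (w / R) ^ (t - 1) < R :=
    hlim.eventually (gt_mem_nhds hR0)
  refine hs.of_norm_bounded_eventually_nat ?_
  filter_upwards [hev, eventually_ge_atTop 1] with t ht ht1
  rw [Real.norm_of_nonneg (by positivity)]
  gcongr
  obtain ⟨n, rfl⟩ := Nat.exists_eq_add_of_le' ht1
  rw [div_pow, ← mul_div_assoc, div_lt_iff₀ (by positivity)] at ht
  simp only [Nat.add_sub_cancel] at ht ⊢
  rw [pow_succ']
  exact ht.le

lemma hasDerivAt_gen {s : ℕ → ℝ} {w : ℝ} (h : ConvergesBeyond s w) (hw : 0 ≤ w) :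
    HasDerivAt (gen s) (∑' t, s t * (t * w ^ (t - 1))) w := by
  obtain ⟨R, hR, hs⟩ := h
  obtain ⟨r, hwr, hrR⟩ := exists_between hR
  have hr0 : 0 < r := hw.trans_lt hwr
  refine hasDerivAt_tsum_of_isPreconnected (t := Metric.ball 0 r)
    (summable_derivative ⟨R, hrR, hs⟩ hr0.le) Metric.isOpen_ball
    (convex_ball 0 r).isPreconnected (g := fun t x => s t * x ^ t)
    (g' := fun t x => s t * (t * x ^ (t - 1)))
    (fun n y _ => (hasDerivAt_pow n y).const_mul _) (fun n y hy => ?_)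
    (Metric.mem_ball_self hr0) ?_ ?_
  · rw [mem_ball_zero_iff] at hy
    simp only [norm_mul, norm_pow, Real.norm_natCast, Real.norm_eq_abs (s n)]
    gcongr
  · refine summable_of_ne_finset_zero (s := {0}) fun t ht => ?_
    simp at ht
    simp [ht]
  · rw [mem_ball_zero_iff, Real.norm_of_nonneg hw]; exact hwr

lemma hasSum_derivative {s : ℕ → ℝ} {w : ℝ} (h : ConvergesBeyond s w) (hw : 0 ≤ w) :
    HasSum (fun t => s t * (t * w ^ (t - 1))) (deriv (gen s) w) := by
  rw [(hasDerivAt_gen h hw).deriv]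
  refine Summable.hasSum ((summable_derivative h hw).of_norm_bounded fun t => ?_)
  rw [norm_mul, Real.norm_of_nonneg (by positivity : 0 ≤ (t : ℝ) * w ^ (t - 1)),
    Real.norm_eq_abs]

lemma hasSum_delay {s : ℕ → ℝ} {w S : ℝ} (h : HasSum (fun t => s t * w ^ t) S) :
    HasSum (fun t => delay s t * w ^ t) (w * S) := by
  rw [← hasSum_nat_add_iff' 1]
  simpa [delay, pow_succ, mul_comm, mul_left_comm, mul_assoc] using h.mul_left w

lemma conv_comm (u v : ℕ → ℝ) (t : ℕ) : conv u v t = conv v u t := by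
  unfold conv
  rw [← Finset.sum_range_reflect]
  refine Finset.sum_congr rfl fun s hs => ?_
  have := Finset.mem_range.1 hs
  rw [mul_comm]
  congr 2
  omega

lemma conv_mul_pow (u v : ℕ → ℝ) (w : ℝ) (t : ℕ) :
    ∑ k ∈ Finset.range (t + 1), (u k * w ^ k) * (v (t - k) * w ^ (t - k))
      = conv u v t * w ^ t := by
  unfold conv
  rw [Finset.sum_mul]
  refine Finset.sum_congr rfl fun s hs => ?_
  have : s + (t - s) = t := by have := Finset.mem_range.1 hs; omega
  calc _ = u s * v (t - s) * w ^ (s + (t - s)) := by rw [pow_add]; ring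
    _ = _ := by rw [this]

lemma hasSum_conv {u v : ℕ → ℝ} {w U V : ℝ} (hu : HasSum (fun t => u t * w ^ t) U)
    (hv : HasSum (fun t => v t * w ^ t) V) : HasSum (fun t => conv u v t * w ^ t) (U * V) := by
  have := (summable_norm_sum_mul_range_of_summable_norm hu.summable.norm
    hv.summable.norm).of_norm.hasSum
  rw [← tsum_mul_tsum_eq_tsum_sum_range_of_summable_norm hu.summable.norm hv.summable.norm,
    hu.tsum_eq, hv.tsum_eq] at this
  simpa only [conv_mul_pow] using this

lemma ConvergesBeyond.conv {u v : ℕ → ℝ} {w : ℝ} (hw : 0 ≤ w) (hu : ConvergesBeyond u w)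
    (hv : ConvergesBeyond v w) : ConvergesBeyond (conv u v) w := by
  obtain ⟨R₁, h₁, hu⟩ := hu.exists_between
  obtain ⟨R₂, h₂, hv⟩ := hv.exists_between
  obtain ⟨r, hwr, hr⟩ := _root_.exists_between (lt_min h₁ h₂)
  have hr0 : 0 ≤ r := hw.trans hwr.le
  refine ⟨r, hwr, ?_⟩
  have := (hasSum_conv ((hu r (hr.trans_le (min_le_left _ _))).hasSum hr0)
    ((hv r (hr.trans_le (min_le_right _ _))).hasSum hr0)).summable.abs
  simpa [abs_mul, abs_of_nonneg hr0] using this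

lemma gen_conv {u v : ℕ → ℝ} {w : ℝ} (hu : Summable fun t => u t * w ^ t)
    (hv : Summable fun t => v t * w ^ t) : gen (conv u v) w = gen u w * gen v w :=
  (hasSum_conv hu.hasSum hv.hasSum).tsum_eq

lemma ConvergesBeyond.summable_of_abs_lt {s : ℕ → ℝ} {w x : ℝ} (h : ConvergesBeyond s w)
    (hx : |x| ≤ w) : Summable fun t => s t * x ^ t := by
  refine (h.summable ((abs_nonneg x).trans hx)).abs.of_norm_bounded fun t => ?_
  rw [norm_mul, norm_pow, abs_mul, abs_pow, Real.norm_eq_abs, Real.norm_eq_abs]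
  exact mul_le_mul_of_nonneg_left
    (pow_le_pow_left₀ (abs_nonneg x) (hx.trans (le_abs_self w)) t) (abs_nonneg _)

/-- The Cauchy product identity holds only where both series converge, so the product rule needs it
on a neighbourhood of `w`; convergence beyond `w` provides one. -/
lemma deriv_gen_conv {u v : ℕ → ℝ} {w : ℝ} (hw : 0 ≤ w) (hu : ConvergesBeyond u w)
    (hv : ConvergesBeyond v w) :
    deriv (gen (conv u v)) w = deriv (gen u) w * gen v w + gen u w * deriv (gen v) w := by
  have hd := (hasDerivAt_gen hu hw).differentiableAt.hasDerivAt.mul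
    (hasDerivAt_gen hv hw).differentiableAt.hasDerivAt
  refine (hd.congr_of_eventuallyEq ?_).deriv
  obtain ⟨R₁, h₁, hu⟩ := hu.exists_between
  obtain ⟨R₂, h₂, hv⟩ := hv.exists_between
  obtain ⟨r, hwr, hr⟩ := _root_.exists_between (lt_min h₁ h₂)
  have : ∀ᶠ x in 𝓝 w, |x| < r :=
    continuous_abs.continuousAt.eventually (gt_mem_nhds (by rwa [abs_of_nonneg hw]))
  filter_upwards [this] with x hx
  exact gen_conv ((hu r (hr.trans_le (min_le_left _ _))).summable_of_abs_lt hx.le)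
    ((hv r (hr.trans_le (min_le_right _ _))).summable_of_abs_lt hx.le)

/-! ### Double power series on the diagonal -/

/-- The double series `∑ c_{i,j} wⁱ wʲ` converges absolutely to `S`. -/
def HasGen₂ (c : ℕ → ℕ → ℝ) (w S : ℝ) : Prop :=
  HasSum (fun n : ℕ × ℕ => c n.1 n.2 * w ^ (n.1 + n.2)) S

lemma HasGen₂.add {b c : ℕ → ℕ → ℝ} {w B C : ℝ} (hb : HasGen₂ b w B) (hc : HasGen₂ c w C) :
    HasGen₂ (fun i j => b i j + c i j) w (B + C) := by
  simpa only [HasGen₂, add_mul] using HasSum.add hb hc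

lemma HasGen₂.sub {b c : ℕ → ℕ → ℝ} {w B C : ℝ} (hb : HasGen₂ b w B) (hc : HasGen₂ c w C) :
    HasGen₂ (fun i j => b i j - c i j) w (B - C) := by
  simpa only [HasGen₂, sub_mul] using HasSum.sub hb hc

lemma HasGen₂.swap {c : ℕ → ℕ → ℝ} {w C : ℝ} (hc : HasGen₂ c w C) :
    HasGen₂ (fun i j => c j i) w C := by
  have := (Equiv.prodComm ℕ ℕ).hasSum_iff.2 hc
  simpa [HasGen₂, Function.comp_def, add_comm] using this

lemma sum_coe_antidiagonal (f : ℕ → ℝ) (n : ℕ) :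
    ∑ x : Finset.HasAntidiagonal.antidiagonal n, f ((x : ℕ × ℕ).1 + (x : ℕ × ℕ).2)
      = (n + 1) * f n := by
  rw [Finset.sum_coe_sort (Finset.HasAntidiagonal.antidiagonal n)
    (fun x : ℕ × ℕ => f (x.1 + x.2)), Finset.sum_congr rfl (g := fun _ => f n)
    (fun x hx => by rw [Finset.HasAntidiagonal.mem_antidiagonal.1 hx])]
  simp

/-- Series of an array that depends on the sum of its indices only. -/
lemma hasGen₂_of_add {s : ℕ → ℝ} {w S : ℝ}
    (hs : HasSum (fun n : ℕ => s n * ((n + 1) * w ^ n)) S) :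
    HasGen₂ (fun i j => s (i + j)) w S := by
  have key : Summable fun n : ℕ × ℕ => s (n.1 + n.2) * w ^ (n.1 + n.2) := by
    -- Regrouping along antidiagonals: `s n * w ^ n` occurs `n + 1` times, once per pair of sum `n`.
    rw [← summable_abs_iff, ← Finset.HasAntidiagonal.sigmaAntidiagonalEquivProd.summable_iff]
    refine (summable_sigma_of_nonneg (fun _ => abs_nonneg _)).2
      ⟨fun n => (hasSum_fintype _).summable, hs.summable.abs.congr fun n => ?_⟩
    rw [tsum_fintype]
    refine Eq.trans ?_ (sum_coe_antidiagonal (fun n => |s n * w ^ n|) n).symm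
    simp only [abs_mul]
    rw [abs_of_nonneg (by positivity : (0 : ℝ) ≤ (n : ℝ) + 1)]
    ring
  have h2 := (Finset.HasAntidiagonal.sigmaAntidiagonalEquivProd.hasSum_iff.2 key.hasSum).sigma
    (fun n => hasSum_fintype _)
  have h3 : HasSum (fun n : ℕ => s n * ((n + 1) * w ^ n))
      (∑' n : ℕ × ℕ, s (n.1 + n.2) * w ^ (n.1 + n.2)) := by
    refine (congrArg (fun f : ℕ → ℝ => HasSum f _) (funext fun n => ?_)).mp h2
    refine (sum_coe_antidiagonal (fun n => s n * w ^ n) n).trans ?_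
    ring
  rw [hs.unique h3]
  exact key.hasSum

/-- A fibre of the regrouping map in `HasGen₂.conv_right`: it lists the summands of one convolution
in the second index. -/
lemma preimage_add_snd (i j : ℕ) :
    (fun x : ℕ × (ℕ × ℕ) => (x.2.1, x.1 + x.2.2)) ⁻¹' {(i, j)}
      = (((Finset.range (j + 1)).image fun k => (k, (i, j - k)) :
        Finset (ℕ × (ℕ × ℕ))) : Set (ℕ × (ℕ × ℕ))) := by
  ext ⟨k, m, n⟩
  simp only [Set.mem_preimage, Set.mem_singleton_iff, Prod.mk.injEq, Finset.coe_image,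
    Set.mem_image, Finset.mem_coe, Finset.mem_range]
  constructor
  · rintro ⟨rfl, rfl⟩; exact ⟨k, by omega, rfl, rfl, by omega⟩
  · rintro ⟨l, hl, rfl, rfl, rfl⟩; exact ⟨rfl, by omega⟩

/-- Convolution in the second index multiplies double series. -/
lemma HasGen₂.conv_right {u : ℕ → ℝ} {b : ℕ → ℕ → ℝ} {w U B : ℝ}
    (hu : HasSum (fun t => u t * w ^ t) U) (hb : HasGen₂ b w B) :
    HasGen₂ (fun i j => conv u (b i) j) w (U * B) := by
  have hb' : HasSum (fun n : ℕ × ℕ => b n.1 n.2 * w ^ (n.1 + n.2)) B := hb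
  have hs : Summable fun x : ℕ × (ℕ × ℕ) =>
      (u x.1 * w ^ x.1) * (b x.2.1 x.2.2 * w ^ (x.2.1 + x.2.2)) :=
    summable_mul_of_summable_norm (f := fun t => u t * w ^ t)
      (g := fun n : ℕ × ℕ => b n.1 n.2 * w ^ (n.1 + n.2)) hu.summable.norm hb'.summable.norm
  have h1 := HasSum.mul hu hb' hs
  have h2 := h1.tsum_fiberwise (fun x => (x.2.1, x.1 + x.2.2))
  have e : ∀ n : ℕ × ℕ, ∑' x : ((fun x : ℕ × (ℕ × ℕ) => (x.2.1, x.1 + x.2.2)) ⁻¹' {n}),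
      (u x.1.1 * w ^ x.1.1) * (b x.1.2.1 x.1.2.2 * w ^ (x.1.2.1 + x.1.2.2))
        = conv u (b n.1) n.2 * w ^ (n.1 + n.2) := by
    rintro ⟨i, j⟩
    rw [preimage_add_snd, Finset.tsum_subtype' _
      (fun x : ℕ × (ℕ × ℕ) => (u x.1 * w ^ x.1) * (b x.2.1 x.2.2 * w ^ (x.2.1 + x.2.2))),
      Finset.sum_image (fun k _ l _ h => by simpa using congrArg Prod.fst h)]
    simp only [conv, Finset.sum_mul]
    refine Finset.sum_congr rfl fun k hk => ?_
    have : i + j = k + (i + (j - k)) := by have := Finset.mem_range.1 hk; omega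
    rw [this, pow_add w k]; ring
  simp only [e] at h2
  exact h2

lemma HasGen₂.conv_left {u : ℕ → ℝ} {b : ℕ → ℕ → ℝ} {w U B : ℝ}
    (hu : HasSum (fun t => u t * w ^ t) U) (hb : HasGen₂ b w B) :
    HasGen₂ (fun i j => conv (b i) u j) w (U * B) := by
  simpa only [conv_comm] using HasGen₂.conv_right hu hb

/-- The multiplicity `n + 1` yields `∑ (n + 1) sₙ wⁿ`, the derivative of `w * gen s w`. With the
index raised by one, as in `hasGen₂_shift_succ`, it yields the derivative of `gen s` itself. -/
lemma hasGen₂_shift {s : ℕ → ℝ} {w : ℝ} (h : ConvergesBeyond s w) (hw : 0 ≤ w) :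
    HasGen₂ (fun i j => s (i + j)) w (gen s w + w * deriv (gen s) w) := by
  refine hasGen₂_of_add ?_
  convert (h.hasSum hw).add ((hasSum_derivative h hw).mul_left w) using 2 with t
  rcases t with _ | t
  · simp
  · simp [pow_succ]; ring

lemma hasGen₂_shift_succ {s : ℕ → ℝ} {w : ℝ} (h : ConvergesBeyond s w) (hw : 0 ≤ w) :
    HasGen₂ (fun i j => s (i + j + 1)) w (deriv (gen s) w) := by
  refine hasGen₂_of_add (s := fun n => s (n + 1)) ?_
  have := (hasSum_nat_add_iff' 1).2 (hasSum_derivative h hw)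
  simpa using this

/-- Accounts for the terms carrying `δ_{τ',0}`. -/
lemma hasGen₂_first_row {s : ℕ → ℝ} {w S : ℝ} (h : HasSum (fun t => s t * w ^ t) S) :
    HasGen₂ (fun i j => if i = 0 then s j else 0) w S := by
  have hinj : Function.Injective (fun j : ℕ => ((0, j) : ℕ × ℕ)) := fun i j h => by
    simpa using h
  refine (hinj.hasSum_iff ?_).1 (by simpa [Function.comp_def] using h)
  rintro ⟨i, j⟩ hij
  have : i ≠ 0 := by rintro rfl; exact hij ⟨j, rfl⟩
  simp [this]

/-! ### Generating functions of the arrays in the state evolution -/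

section
variable {p q θ : ℕ → ℝ} {w : ℝ}

lemma hasGen₂_coeffD (hw : 0 ≤ w) (hp : ConvergesBeyond p w) (hq : ConvergesBeyond q w)
    (hθ : ConvergesBeyond θ w) :
    HasGen₂ (coeffD p q θ) w (gen p w * deriv (gen (conv q θ)) w
      - gen (conv q θ) w * deriv (gen p) w) := by
  have hr := hq.conv hw hθ
  exact ((hasGen₂_shift_succ hr hw).conv_right (hp.hasSum hw)).sub
    ((hasGen₂_shift_succ hp hw).conv_right (hr.hasSum hw))

lemma hasGen₂_coeffNoise (hw : 0 ≤ w) (hq : ConvergesBeyond q w) (hθ : ConvergesBeyond θ w) :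
    HasGen₂ (coeffNoise q θ) w (gen q w * (gen q w *
      (gen θ w + w * deriv (gen θ) w - deriv (gen θ) w))) := by
  have h1 := ((hasGen₂_shift hθ hw).sub (hasGen₂_shift_succ hθ hw)).conv_right (hq.hasSum hw)
  -- The two-dimensional convolution with `q_{τ'} q_τ` is a convolution in each index in turn;
  -- swapping the indices reduces both to `conv_right`.
  have h2 := (h1.swap.conv_right (hq.hasSum hw)).swap
  convert h2 using 3 with i j
  simp only [coeffNoise, conv, Finset.mul_sum, mul_assoc]

/-- With `r = q * θ`, the first two summands of `coeffA` give the part without `r`. The next two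
give `w - 1` times `P R' - R P'`, where `P, R` are the generating functions of `p, r`. The last two
give `w` times it, as the first-row terms cancel `P R - R P`. Hence the factor `2 * w - 1`. -/
lemma hasGen₂_coeffA (hw : 0 ≤ w) (hp : ConvergesBeyond p w) (hq : ConvergesBeyond q w)
    (hθ : ConvergesBeyond θ w) :
    HasGen₂ (coeffA p q θ) w (gen p w * gen q w
      + (1 - w) * (gen p w * deriv (gen q) w - deriv (gen p) w * gen q w)
      + (2 * w - 1) * (gen p w * deriv (gen (conv q θ)) w
        - gen (conv q θ) w * deriv (gen p) w)) := by
  have hr := hq.conv hw hθ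
  have sp := hp.hasSum hw
  have sq := hq.hasSum hw
  have sr := hr.hasSum hw
  have dp : HasSum (fun t => (p t - delay p t) * w ^ t) (gen p w - w * gen p w) := by
    simpa only [sub_mul] using sp.sub (hasSum_delay sp)
  have dp' : HasSum (fun t => (delay p t - p t) * w ^ t) (w * gen p w - gen p w) := by
    simpa only [sub_mul] using (hasSum_delay sp).sub sp
  have dr : HasSum (fun t => (conv q θ t - delay (conv q θ) t) * w ^ t)
      (gen (conv q θ) w - w * gen (conv q θ) w) := by
    simpa only [sub_mul] using sr.sub (hasSum_delay sr)
  have h := ((((((hasGen₂_shift hp hw).sub (hasGen₂_shift_succ hp hw)).conv_left sq).add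
    ((hasGen₂_shift_succ hq hw).conv_right dp)).add
    ((hasGen₂_shift_succ hr hw).conv_right dp')).add
    ((hasGen₂_shift_succ hp hw).conv_right dr)).add
    (((hasGen₂_shift hr hw).sub (hasGen₂_first_row sr)).conv_right sp)
  have h := h.sub (((hasGen₂_shift hp hw).sub (hasGen₂_first_row sp)).conv_right sr)
  refine Eq.mp (congrArg (HasGen₂ _ w) ?_) h
  ring

end

/-! ### Moments of the posterior distribution -/

/-- The unnormalized `k`-th posterior moment of `x ∼ π` given `x + z = u`, `z ∼ N(0, v)`. -/
noncomputable def postMoment (π : Measure ℝ) (k : ℕ) (v u : ℝ) : ℝ :=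
  ∫ x, x ^ k * Real.exp (-(u - x) ^ 2 / (2 * v)) ∂π

/-- The unnormalized posterior variance of `x ∼ π` given `x + z = u`, `z ∼ N(0, v)`. -/
noncomputable def postVar (π : Measure ℝ) (v u : ℝ) : ℝ :=
  ∫ x, (fOpt π v u - x) ^ 2 * Real.exp (-(u - x) ^ 2 / (2 * v)) ∂π

lemma exp_neg_sq_div_le_one {v : ℝ} (hv : 0 ≤ v) (t : ℝ) :
    Real.exp (-t ^ 2 / (2 * v)) ≤ 1 := by
  rw [Real.exp_le_one_iff, neg_div]
  have : 0 ≤ t ^ 2 / (2 * v) := by positivity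
  linarith

/-- A bound uniform in `t`, so that differentiation in `u` under the integral is dominated; it
follows from `1 + s ≤ exp s`. -/
lemma abs_mul_exp_neg_sq_div_le {v : ℝ} (hv : 0 < v) (t : ℝ) :
    |t| * Real.exp (-t ^ 2 / (2 * v)) ≤ 1 + v := by
  rw [neg_div, Real.exp_neg, ← div_eq_mul_inv, div_le_iff₀ (Real.exp_pos _)]
  have h1 := Real.add_one_le_exp (t ^ 2 / (2 * v))
  have h2 : |t| ≤ 1 + t ^ 2 / 2 := by
    nlinarith [sq_nonneg (|t| - 1), sq_abs t]
  have h3 : v * (t ^ 2 / (2 * v)) = t ^ 2 / 2 := by field_simp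
  have h4 : 0 ≤ t ^ 2 / (2 * v) := by positivity
  nlinarith

section
variable {π : Measure ℝ} {v : ℝ}

lemma integrable_mul_exp {f : ℝ → ℝ} (hf : Integrable f π) (hv : 0 ≤ v) (u : ℝ) :
    Integrable (fun x => f x * Real.exp (-(u - x) ^ 2 / (2 * v))) π := by
  refine hf.mul_bdd (c := 1) (by fun_prop) (ae_of_all _ fun x => ?_)
  rw [Real.norm_of_nonneg (Real.exp_nonneg _)]
  exact exp_neg_sq_div_le_one hv _

lemma postMoment_zero_pos [IsProbabilityMeasure π] (hv : 0 ≤ v) (u : ℝ) :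
    0 < postMoment π 0 v u := by
  have hi := integrable_mul_exp (integrable_const (1 : ℝ) (μ := π)) hv u
  simp only [postMoment, pow_zero]
  rw [integral_pos_iff_support_of_nonneg (fun x => by positivity) hi]
  have : Function.support (fun x => (1 : ℝ) * Real.exp (-(u - x) ^ 2 / (2 * v))) = Set.univ := by
    ext x; simp [Real.exp_ne_zero]
  rw [this]
  simp

lemma fOpt_eq (hv : v ≠ 0) (u : ℝ) :
    fOpt π v u = postMoment π 1 v u / postMoment π 0 v u := by
  simp [fOpt, hv, postMoment]

lemma integral_sq_sub_mul_exp [IsProbabilityMeasure π] (hπ : MemLp id 2 π) (hv : 0 ≤ v)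
    (u g : ℝ) :
    ∫ x, (g - x) ^ 2 * Real.exp (-(u - x) ^ 2 / (2 * v)) ∂π
      = g ^ 2 * postMoment π 0 v u - 2 * g * postMoment π 1 v u + postMoment π 2 v u := by
  have h1 : Integrable (fun x : ℝ => x) π := hπ.integrable one_le_two
  have h2 : Integrable (fun x : ℝ => x ^ 2) π := hπ.integrable_sq
  have e : ∀ x : ℝ, (g - x) ^ 2 * Real.exp (-(u - x) ^ 2 / (2 * v))
      = g ^ 2 * (x ^ 0 * Real.exp (-(u - x) ^ 2 / (2 * v)))
        - 2 * g * (x ^ 1 * Real.exp (-(u - x) ^ 2 / (2 * v)))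
        + x ^ 2 * Real.exp (-(u - x) ^ 2 / (2 * v)) := fun x => by ring
  simp only [e]
  have i0 : Integrable (fun x : ℝ => x ^ 0 * Real.exp (-(u - x) ^ 2 / (2 * v))) π := by
    simpa using integrable_mul_exp (integrable_const (1 : ℝ) (μ := π)) hv u
  have i1 : Integrable (fun x : ℝ => x ^ 1 * Real.exp (-(u - x) ^ 2 / (2 * v))) π := by
    simpa using integrable_mul_exp h1 hv u
  have i2 := integrable_mul_exp h2 hv u
  have i01 : Integrable (fun x : ℝ => g ^ 2 * (x ^ 0 * Real.exp (-(u - x) ^ 2 / (2 * v)))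
      - 2 * g * (x ^ 1 * Real.exp (-(u - x) ^ 2 / (2 * v)))) π :=
    (i0.const_mul _).sub (i1.const_mul _)
  rw [integral_add i01 i2,
    integral_sub (i0.const_mul _) (i1.const_mul _), integral_const_mul, integral_const_mul]
  rfl

lemma postVar_eq [IsProbabilityMeasure π] (hπ : MemLp id 2 π) (hv : 0 < v) (u : ℝ) :
    postVar π v u = postMoment π 2 v u - postMoment π 1 v u ^ 2 / postMoment π 0 v u := by
  have := (postMoment_zero_pos (π := π) hv.le u).ne'
  rw [postVar, integral_sq_sub_mul_exp hπ hv.le, fOpt_eq hv.ne']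
  field_simp
  ring

lemma postVar_nonneg (π : Measure ℝ) (v u : ℝ) : 0 ≤ postVar π v u :=
  integral_nonneg fun x => by positivity

/-- The posterior mean minimizes the posterior quadratic risk. -/
lemma postVar_le [IsProbabilityMeasure π] (hπ : MemLp id 2 π) (hv : 0 < v) (u g : ℝ) :
    postVar π v u ≤ ∫ x, (g - x) ^ 2 * Real.exp (-(u - x) ^ 2 / (2 * v)) ∂π := by
  have h0 := postMoment_zero_pos (π := π) hv.le u
  rw [integral_sq_sub_mul_exp hπ hv.le, postVar_eq hπ hv]
  have : g ^ 2 * postMoment π 0 v u - 2 * g * postMoment π 1 v u + postMoment π 2 v u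
      - (postMoment π 2 v u - postMoment π 1 v u ^ 2 / postMoment π 0 v u)
      = (g - postMoment π 1 v u / postMoment π 0 v u) ^ 2 * postMoment π 0 v u := by
    field_simp
    ring
  nlinarith [mul_nonneg (sq_nonneg (g - postMoment π 1 v u / postMoment π 0 v u)) h0.le]

/-- Nonnegativity of the posterior variance. Integrated over `u`, it bounds the second moment of the
posterior mean by that of the signal. -/
lemma sq_fOpt_mul_le [IsProbabilityMeasure π] (hπ : MemLp id 2 π) (hv : 0 < v) (u : ℝ) :
    fOpt π v u ^ 2 * postMoment π 0 v u ≤ postMoment π 2 v u := by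
  have h0 := (postMoment_zero_pos (π := π) hv.le u).ne'
  have h := postVar_nonneg π v u
  rw [postVar_eq hπ hv] at h
  have : fOpt π v u ^ 2 * postMoment π 0 v u
      = postMoment π 1 v u ^ 2 / postMoment π 0 v u := by
    rw [fOpt_eq hv.ne']; field_simp
  linarith

lemma postVar_le_postMoment [IsProbabilityMeasure π] (hπ : MemLp id 2 π) (hv : 0 < v) (u : ℝ) :
    postVar π v u ≤ postMoment π 2 v u := by
  simpa [postMoment] using postVar_le hπ hv u 0

/-- Differentiating the Gaussian weight produces the factor `(x - u) / v`, which raises the moment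
by one. -/
lemma hasDerivAt_postMoment {k : ℕ} (hk : Integrable (fun x : ℝ => x ^ k) π)
    (hk' : Integrable (fun x : ℝ => x ^ (k + 1)) π) (hv : 0 < v) (u : ℝ) :
    HasDerivAt (postMoment π k v)
      ((postMoment π (k + 1) v u - u * postMoment π k v u) / v) u := by
  have key := hasDerivAt_integral_of_dominated_loc_of_deriv_le (μ := π) (x₀ := u)
    (F := fun u x => x ^ k * Real.exp (-(u - x) ^ 2 / (2 * v)))
    (F' := fun u x => x ^ k * (Real.exp (-(u - x) ^ 2 / (2 * v)) * (-(u - x) / v)))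
    (bound := fun x => |x ^ k| * ((1 + v) / v)) (s := Set.univ) univ_mem
    (Eventually.of_forall fun u => by fun_prop) (integrable_mul_exp hk hv.le u) (by fun_prop)
    (ae_of_all _ fun x u _ => ?_) (hk.abs.mul_const _) (ae_of_all _ fun x u _ => ?_)
  · refine key.2.congr_deriv ?_
    have i1 := integrable_mul_exp hk' hv.le u
    have i0 := integrable_mul_exp hk hv.le u
    rw [postMoment, postMoment, ← integral_const_mul, ← integral_sub i1 (i0.const_mul u),
      ← integral_div]
    refine integral_congr_ae (ae_of_all _ fun x => ?_)
    have : ∀ E : ℝ, x ^ k * (E * (-(u - x) / v)) = (x ^ (k + 1) * E - u * (x ^ k * E)) / v := by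
      intro E
      rw [pow_succ]
      field_simp
      ring
    exact this _
  · rw [norm_mul, Real.norm_eq_abs, Real.norm_eq_abs, abs_mul, abs_div, abs_neg,
      abs_of_pos (Real.exp_pos _), abs_of_pos hv]
    gcongr
    rw [mul_div_assoc', mul_comm]
    gcongr
    exact abs_mul_exp_neg_sq_div_le hv _
  · refine ((Real.hasDerivAt_exp _).comp u ?_).const_mul _
    have h1 : HasDerivAt (fun u : ℝ => -(u - x) ^ 2 / (2 * v))
        (-(2 * (u - x)) / (2 * v)) u := by
      simpa using ((((hasDerivAt_id u).sub_const x).pow 2).neg).div_const (2 * v)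
    exact h1.congr_deriv (by field_simp)

/-- The derivative of the posterior mean is the posterior variance over the noise variance. -/
lemma hasDerivAt_fOpt [IsProbabilityMeasure π] (hπ : MemLp id 2 π) (hv : 0 < v) (u : ℝ) :
    HasDerivAt (fOpt π v) (postVar π v u / (v * postMoment π 0 v u)) u := by
  have h1 : Integrable (fun x : ℝ => x) π := hπ.integrable one_le_two
  have h2 : Integrable (fun x : ℝ => x ^ 2) π := hπ.integrable_sq
  have h0 := (postMoment_zero_pos (π := π) hv.le u).ne'
  have e : fOpt π v = fun u => postMoment π 1 v u / postMoment π 0 v u :=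
    funext fun u => fOpt_eq hv.ne' u
  rw [e]
  refine ((hasDerivAt_postMoment (k := 1) (by simpa using h1) h2 hv u).div
    (hasDerivAt_postMoment (k := 0) (by simp) (by simpa using h1) hv u) h0).congr_deriv ?_
  rw [postVar_eq hπ hv]
  field_simp
  ring

lemma measurable_fOpt [IsProbabilityMeasure π] (hπ : MemLp id 2 π) (hv : 0 ≤ v) :
    Measurable (fOpt π v) := by
  rcases hv.eq_or_lt with rfl | hv
  · have : fOpt π 0 = id := by ext u; simp [fOpt]
    rw [this]; exact measurable_id
  · exact (continuous_iff_continuousAt.2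
      fun u => (hasDerivAt_fOpt hπ hv u).continuousAt).measurable

lemma continuousAt_postMoment {k : ℕ} (hk : Integrable (fun x : ℝ => x ^ k) π) (hv : 0 < v)
    (u : ℝ) : ContinuousAt (fun v => postMoment π k v u) v := by
  refine tendsto_integral_filter_of_dominated_convergence (fun x => |x ^ k|)
    (Eventually.of_forall fun v => by fun_prop) ?_ hk.abs (ae_of_all _ fun x => ?_)
  · filter_upwards [lt_mem_nhds hv] with y hy
    refine ae_of_all _ fun x => ?_
    rw [norm_mul, Real.norm_eq_abs, Real.norm_of_nonneg (Real.exp_nonneg _)]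
    exact mul_le_of_le_one_right (abs_nonneg _) (exp_neg_sq_div_le_one (le_of_lt hy) _)
  · have : 2 * v ≠ 0 := by positivity
    have hc : ContinuousAt (fun y : ℝ => x ^ k * Real.exp (-(u - x) ^ 2 / (2 * y))) v := by
      fun_prop (disch := assumption)
    exact hc

lemma continuousAt_postVar [IsProbabilityMeasure π] (hπ : MemLp id 2 π) (hv : 0 < v) (u : ℝ) :
    ContinuousAt (fun v => postVar π v u) v := by
  have h1 : Integrable (fun x : ℝ => x) π := hπ.integrable one_le_two
  have h2 : Integrable (fun x : ℝ => x ^ 2) π := hπ.integrable_sq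
  have h0 := (postMoment_zero_pos (π := π) hv.le u).ne'
  have hc := (continuousAt_postMoment h2 hv u).sub
    (((continuousAt_postMoment (k := 1) (by simpa using h1) hv u).pow 2).div
      (continuousAt_postMoment (k := 0) (by simp) hv u) h0)
  refine hc.congr ?_
  filter_upwards [lt_mem_nhds hv] with y hy
  exact (postVar_eq hπ hy u).symm

/-- The weight increases with the noise variance, so the largest variance in a window dominates all
others. -/
lemma postMoment_two_mono [IsProbabilityMeasure π] (hπ : MemLp id 2 π) {v' : ℝ} (hv : 0 < v)
    (hvv : v ≤ v') (u : ℝ) : postMoment π 2 v u ≤ postMoment π 2 v' u := by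
  have h2 : Integrable (fun x : ℝ => x ^ 2) π := hπ.integrable_sq
  refine integral_mono (integrable_mul_exp h2 hv.le u)
    (integrable_mul_exp h2 (hv.le.trans hvv) u) fun x => ?_
  simp only [neg_div]
  gcongr

end

/-! ### The Gaussian channel -/

section
variable {π : Measure ℝ} {v : ℝ}

lemma gaussianPDFReal_toNNReal (hv : 0 < v) (x u : ℝ) :
    gaussianPDFReal x v.toNNReal u
      = (√(2 * Real.pi * v))⁻¹ * Real.exp (-(u - x) ^ 2 / (2 * v)) := by
  rw [gaussianPDFReal_def, Real.coe_toNNReal _ hv.le]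

lemma measurable_gaussianPDF_uncurry (V : NNReal) :
    Measurable fun p : ℝ × ℝ => gaussianPDF p.1 V p.2 := by
  unfold gaussianPDF gaussianPDFReal
  fun_prop

/-- The joint law of the input and the output of the Gaussian channel has a density. -/
lemma map_channel [SFinite π] {V : NNReal} (hV : V ≠ 0) :
    (π.prod (gaussianReal 0 V)).map (fun p => (p.1, p.1 + p.2))
      = (π.prod volume).withDensity fun p => gaussianPDF p.1 V p.2 := by
  ext s hs
  rw [Measure.map_apply (by fun_prop) hs,
    Measure.prod_apply (measurableSet_preimage (by fun_prop) hs),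
    withDensity_apply _ hs, ← lintegral_indicator hs,
    lintegral_prod _ ((measurable_gaussianPDF_uncurry V).indicator hs).aemeasurable]
  refine lintegral_congr fun x => ?_
  have hs' : MeasurableSet (Prod.mk x ⁻¹' s) := measurable_prodMk_left hs
  have e : Prod.mk x ⁻¹' ((fun p : ℝ × ℝ => (p.1, p.1 + p.2)) ⁻¹' s)
      = (fun z => x + z) ⁻¹' (Prod.mk x ⁻¹' s) := rfl
  rw [e, ← Measure.map_apply (by fun_prop) hs', gaussianReal_map_const_add, zero_add,
    gaussianReal_apply _ hV, ← lintegral_indicator hs']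
  rfl

lemma integrable_channel_iff [SFinite π] (hv : 0 < v) {F : ℝ × ℝ → ℝ} (hF : Measurable F) :
    Integrable (fun p => F (p.1, p.1 + p.2)) (π.prod (gaussianReal 0 v.toNNReal)) ↔
      Integrable (fun p : ℝ × ℝ => gaussianPDFReal p.1 v.toNNReal p.2 * F p)
        (π.prod volume) := by
  have hV : v.toNNReal ≠ 0 := by simpa using hv
  have h1 := integrable_map_measure (μ := π.prod (gaussianReal 0 v.toNNReal)) (g := F)
    (f := fun p : ℝ × ℝ => (p.1, p.1 + p.2)) hF.aestronglyMeasurable (by fun_prop)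
  rw [map_channel hV, integrable_withDensity_iff_integrable_smul'
    (measurable_gaussianPDF_uncurry _) (ae_of_all _ fun p => gaussianPDF_lt_top)] at h1
  simpa only [toReal_gaussianPDF, smul_eq_mul, Function.comp_def] using h1.symm

lemma integral_channel [SFinite π] (hv : 0 < v) {F : ℝ × ℝ → ℝ} (hF : Measurable F)
    (hi : Integrable (fun p => F (p.1, p.1 + p.2)) (π.prod (gaussianReal 0 v.toNNReal))) :
    ∫ p, F (p.1, p.1 + p.2) ∂(π.prod (gaussianReal 0 v.toNNReal))
      = ∫ u, (√(2 * Real.pi * v))⁻¹ *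
          ∫ x, F (x, u) * Real.exp (-(u - x) ^ 2 / (2 * v)) ∂π := by
  have hV : v.toNNReal ≠ 0 := by simpa using hv
  have h1 := integral_map (μ := π.prod (gaussianReal 0 v.toNNReal)) (f := F)
    (φ := fun p : ℝ × ℝ => (p.1, p.1 + p.2)) (by fun_prop) hF.aestronglyMeasurable
  rw [map_channel hV, integral_withDensity_eq_integral_toReal_smul
    (measurable_gaussianPDF_uncurry _) (ae_of_all _ fun p => gaussianPDF_lt_top)] at h1
  rw [← h1]
  simp only [toReal_gaussianPDF, smul_eq_mul]
  rw [integral_prod_symm _ ((integrable_channel_iff hv hF).1 hi)]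
  refine integral_congr_ae (ae_of_all _ fun u => ?_)
  simp only [gaussianPDFReal_toNNReal hv]
  rw [← integral_const_mul]
  refine integral_congr_ae (ae_of_all _ fun x => ?_)
  simp only
  ring

lemma integrable_integral_channel [SFinite π] (hv : 0 < v) {F : ℝ × ℝ → ℝ} (hF : Measurable F)
    (hi : Integrable (fun p => F (p.1, p.1 + p.2)) (π.prod (gaussianReal 0 v.toNNReal))) :
    Integrable fun u => ∫ x, F (x, u) * Real.exp (-(u - x) ^ 2 / (2 * v)) ∂π := by
  have h := (((integrable_channel_iff hv hF).1 hi).integral_prod_right).const_mul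
    (√(2 * Real.pi * v))
  refine h.congr (ae_of_all _ fun u => ?_)
  have hc : √(2 * Real.pi * v) ≠ 0 := by positivity
  simp only [gaussianPDFReal_toNNReal hv]
  rw [← integral_const_mul]
  refine integral_congr_ae (ae_of_all _ fun x => ?_)
  simp only
  field_simp

/-- Functions of the output of the channel. -/
lemma integrable_channel_snd [IsProbabilityMeasure π] (hv : 0 < v) {g : ℝ → ℝ}
    (hg : Measurable g) (hi : Integrable fun u => g u * postMoment π 0 v u) :
    Integrable (fun p => g (p.1 + p.2)) (π.prod (gaussianReal 0 v.toNNReal)) := by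
  have hF : Measurable fun p : ℝ × ℝ => g p.2 := hg.comp measurable_snd
  refine (integrable_channel_iff hv hF).2 ?_
  have hm : Measurable fun p : ℝ × ℝ => gaussianPDFReal p.1 v.toNNReal p.2 * g p.2 := by
    unfold gaussianPDFReal
    fun_prop
  have h1 := fun u => integrable_mul_exp (integrable_const (1 : ℝ) (μ := π)) hv.le u
  refine (integrable_prod_iff' hm.aestronglyMeasurable).2 ⟨ae_of_all _ fun u => ?_, ?_⟩
  · simp only [gaussianPDFReal_toNNReal hv]
    refine Integrable.mul_const (Integrable.const_mul ?_ _) _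
    simpa using h1 u
  · refine (hi.abs.const_mul (√(2 * Real.pi * v))⁻¹).congr (ae_of_all _ fun u => ?_)
    simp only [gaussianPDFReal_toNNReal hv, norm_mul, Real.norm_eq_abs, Real.abs_exp]
    rw [abs_mul, abs_of_pos (postMoment_zero_pos hv.le u), integral_mul_const,
      integral_const_mul, abs_of_nonneg (by positivity : 0 ≤ (√(2 * Real.pi * v))⁻¹)]
    simp only [postMoment, pow_zero, one_mul]
    ring

lemma integral_channel_snd [IsProbabilityMeasure π] (hv : 0 < v) {g : ℝ → ℝ}
    (hg : Measurable g) (hi : Integrable fun u => g u * postMoment π 0 v u) :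
    ∫ p, g (p.1 + p.2) ∂(π.prod (gaussianReal 0 v.toNNReal))
      = ∫ u, (√(2 * Real.pi * v))⁻¹ * (g u * postMoment π 0 v u) := by
  rw [integral_channel hv (F := fun p => g p.2) (hg.comp measurable_snd)
    (integrable_channel_snd hv hg hi)]
  simp only [integral_const_mul, postMoment, pow_zero, one_mul]

lemma memLp_fst (hπ : MemLp id 2 π) (V : NNReal) :
    MemLp (fun p : ℝ × ℝ => p.1) 2 (π.prod (gaussianReal 0 V)) :=
  hπ.comp_fst (gaussianReal 0 V)

variable [IsProbabilityMeasure π]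

lemma integrable_postMoment_two (hπ : MemLp id 2 π) (hv : 0 < v) :
    Integrable fun u => postMoment π 2 v u := by
  have h2 : Integrable (fun x : ℝ => x ^ 2) π := hπ.integrable_sq
  exact integrable_integral_channel (F := fun p => p.1 ^ 2) hv (by fun_prop) (h2.comp_fst _)

lemma memLp_snd (V : NNReal) :
    MemLp (fun p : ℝ × ℝ => p.2) 2 (π.prod (gaussianReal 0 V)) :=
  (memLp_id_gaussianReal' 2 (by simp)).comp_snd π

lemma memLp_fOpt (hπ : MemLp id 2 π) (hv : 0 ≤ v) :
    MemLp (fun p : ℝ × ℝ => fOpt π v (p.1 + p.2)) 2 (π.prod (gaussianReal 0 v.toNNReal)) := by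
  have hm : Measurable (fOpt π v) := measurable_fOpt hπ hv
  rcases hv.eq_or_lt with rfl | hv
  · have := (memLp_fst hπ (0 : ℝ).toNNReal).add (memLp_snd (π := π) (0 : ℝ).toNNReal)
    simpa [fOpt, Pi.add_def] using this
  have hm' : Measurable fun p : ℝ × ℝ => fOpt π v (p.1 + p.2) := hm.comp (by fun_prop)
  rw [memLp_two_iff_integrable_sq hm'.aestronglyMeasurable]
  refine integrable_channel_snd (g := fun u => fOpt π v u ^ 2) hv (hm.pow_const 2) ?_
  refine (integrable_postMoment_two hπ hv).mono'
    ((hm.pow_const 2).aestronglyMeasurable.mul ?_) (ae_of_all _ fun u => ?_)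
  · have h1 : Integrable (fun x : ℝ => x) π := hπ.integrable one_le_two
    exact (continuous_iff_continuousAt.2 fun u => (hasDerivAt_postMoment (k := 0) (by simp)
      (by simpa using h1) hv u).continuousAt).aestronglyMeasurable
  · rw [Real.norm_of_nonneg (mul_nonneg (sq_nonneg _) (postMoment_zero_pos hv.le u).le)]
    exact sq_fOpt_mul_le hπ hv u

lemma memLp_fOpt_sub (hπ : MemLp id 2 π) (hv : 0 ≤ v) :
    MemLp (fun p : ℝ × ℝ => fOpt π v (p.1 + p.2) - p.1) 2
      (π.prod (gaussianReal 0 v.toNNReal)) :=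
  (memLp_fOpt hπ hv).sub (memLp_fst hπ _)

lemma measurable_fOpt_sub (hπ : MemLp id 2 π) (hv : 0 ≤ v) :
    Measurable fun p : ℝ × ℝ => (fOpt π v p.2 - p.1) ^ 2 := by
  have := measurable_fOpt hπ hv
  fun_prop

lemma scalarMMSE_eq (hπ : MemLp id 2 π) (hv : 0 < v) :
    scalarMMSE π v = ∫ u, (√(2 * Real.pi * v))⁻¹ * postVar π v u :=
  integral_channel (F := fun p => (fOpt π v p.2 - p.1) ^ 2) hv (measurable_fOpt_sub hπ hv.le)
    (memLp_fOpt_sub hπ hv.le).integrable_sq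

lemma integrable_postVar (hπ : MemLp id 2 π) (hv : 0 < v) : Integrable (postVar π v) :=
  integrable_integral_channel (F := fun p => (fOpt π v p.2 - p.1) ^ 2) hv
    (measurable_fOpt_sub hπ hv.le) (memLp_fOpt_sub hπ hv.le).integrable_sq

/-- The average slope of the posterior mean is the mean square error over the noise variance. -/
lemma integral_deriv_fOpt (hπ : MemLp id 2 π) (hv : 0 < v) :
    ∫ p, deriv (fOpt π v) (p.1 + p.2) ∂(π.prod (gaussianReal 0 v.toNNReal))
      = scalarMMSE π v / v := by
  have e : ∀ u, deriv (fOpt π v) u * postMoment π 0 v u = postVar π v u / v := fun u => by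
    have := (postMoment_zero_pos (π := π) hv.le u).ne'
    rw [(hasDerivAt_fOpt hπ hv u).deriv]
    field_simp
  rw [integral_channel_snd hv (measurable_deriv _)
    (by simpa only [e] using (integrable_postVar hπ hv).div_const v), scalarMMSE_eq hπ hv,
    ← integral_div]
  simp only [e, mul_div_assoc]

/-- The linear estimator bounds the minimum mean square error. -/
lemma scalarMMSE_le (hπ : MemLp id 2 π) (h1 : ∫ x, x ∂π = 0) (h2 : ∫ x, x ^ 2 ∂π = 1)
    (hv : 0 < v) : scalarMMSE π v ≤ v / (1 + v) := by
  -- The best linear estimator `u / (1 + v)` has error `(z - v x) / (1 + v)`, of second moment `(v +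
  -- v²) / (1 + v)² = v / (1 + v)`.
  have hL : MemLp (fun p : ℝ × ℝ => (p.1 + p.2) / (1 + v) - p.1) 2
      (π.prod (gaussianReal 0 v.toNNReal)) := by
    simp only [div_eq_inv_mul]
    exact (((memLp_fst hπ v.toNNReal).add (memLp_snd v.toNNReal)).const_mul
      (1 + v)⁻¹).sub (memLp_fst hπ v.toNNReal)
  have hF : Measurable fun p : ℝ × ℝ => (p.2 / (1 + v) - p.1) ^ 2 := by fun_prop
  have hle : scalarMMSE π v ≤ ∫ p : ℝ × ℝ, ((p.1 + p.2) / (1 + v) - p.1) ^ 2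
      ∂(π.prod (gaussianReal 0 v.toNNReal)) := by
    rw [integral_channel (F := fun p => (p.2 / (1 + v) - p.1) ^ 2) hv hF hL.integrable_sq,
      scalarMMSE_eq hπ hv]
    refine integral_mono ((integrable_postVar hπ hv).const_mul _)
      ((integrable_integral_channel hv hF hL.integrable_sq).const_mul _) fun u => ?_
    exact mul_le_mul_of_nonneg_left (postVar_le hπ hv u (u / (1 + v))) (by positivity)
  refine hle.trans_eq ?_
  have ix := (memLp_fst hπ v.toNNReal).integrable_sq
  have iz := (memLp_snd (π := π) v.toNNReal).integrable_sq
  have ixz : Integrable (fun p : ℝ × ℝ => p.1 * p.2) (π.prod (gaussianReal 0 v.toNNReal)) :=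
    (memLp_fst hπ v.toNNReal).integrable_mul (memLp_snd (π := π) v.toNNReal)
  have hv1 : 1 + v ≠ 0 := by positivity
  have e : ∀ p : ℝ × ℝ, ((p.1 + p.2) / (1 + v) - p.1) ^ 2
      = (v ^ 2 / (1 + v) ^ 2) * p.1 ^ 2 + (1 / (1 + v) ^ 2) * p.2 ^ 2
        - (2 * v / (1 + v) ^ 2) * (p.1 * p.2) := fun p => by
    field_simp
    ring
  simp only [e]
  have hz2 : ∫ z, z ^ 2 ∂gaussianReal 0 v.toNNReal = v := by
    have := variance_fun_id_gaussianReal (μ := 0) (v := v.toNNReal)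
    rw [variance_of_integral_eq_zero (by fun_prop) (by simp), Real.coe_toNNReal _ hv.le] at this
    exact this
  have hx2 : ∫ p : ℝ × ℝ, p.1 ^ 2 ∂(π.prod (gaussianReal 0 v.toNNReal)) = 1 := by
    rw [integral_fun_fst (fun x : ℝ => x ^ 2)]; simp [h2]
  have hz2' : ∫ p : ℝ × ℝ, p.2 ^ 2 ∂(π.prod (gaussianReal 0 v.toNNReal)) = v := by
    rw [integral_fun_snd (fun x : ℝ => x ^ 2)]; simp [hz2]
  have hxz : ∫ p : ℝ × ℝ, p.1 * p.2 ∂(π.prod (gaussianReal 0 v.toNNReal)) = 0 := by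
    rw [integral_prod_mul (fun x : ℝ => x) (fun z : ℝ => z), h1, zero_mul]
  have i12 : Integrable (fun p : ℝ × ℝ => (v ^ 2 / (1 + v) ^ 2) * p.1 ^ 2
      + (1 / (1 + v) ^ 2) * p.2 ^ 2) (π.prod (gaussianReal 0 v.toNNReal)) :=
    (ix.const_mul _).add (iz.const_mul _)
  rw [integral_sub i12 (ixz.const_mul _), integral_add (ix.const_mul _)
    (iz.const_mul _), integral_const_mul, integral_const_mul, integral_const_mul, hx2, hz2', hxz]
  field_simp
  ring

/-- A signal of positive variance is not recovered exactly. -/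
lemma scalarMMSE_pos (hπ : MemLp id 2 π) (h1 : ∫ x, x ∂π = 0) (h2 : ∫ x, x ^ 2 ∂π = 1)
    (hv : 0 < v) : 0 < scalarMMSE π v := by
  rw [scalarMMSE_eq hπ hv]
  have hc : 0 < (√(2 * Real.pi * v))⁻¹ := by positivity
  have hn : 0 ≤ fun u => (√(2 * Real.pi * v))⁻¹ * postVar π v u :=
    fun u => mul_nonneg hc.le (postVar_nonneg _ _ _)
  -- Zero error forces zero posterior variance at some output `u`. As the Gaussian weight never
  -- vanishes, `x` is then almost surely constant, against mean `0` and second moment `1`.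
  refine (integral_nonneg hn).lt_of_ne fun h0 => ?_
  rw [eq_comm, integral_eq_zero_iff_of_nonneg hn ((integrable_postVar hπ hv).const_mul _)] at h0
  obtain ⟨u, hu⟩ := h0.exists
  have hu0 : postVar π v u = 0 := by simpa [hc.ne'] using hu
  have hm : MemLp (fun x => fOpt π v u - x) 2 π := (memLp_const _).sub hπ
  rw [postVar, integral_eq_zero_iff_of_nonneg (fun x => by positivity)
    (integrable_mul_exp hm.integrable_sq hv.le u)] at hu0
  have hx : ∀ᵐ x ∂π, x = fOpt π v u := by
    filter_upwards [hu0] with x hx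
    have : fOpt π v u - x = 0 := by simpa [Real.exp_ne_zero] using hx
    linarith
  have e1 : ∫ x, x ∂π = fOpt π v u := by
    rw [integral_congr_ae hx]; simp
  have e2 : ∫ x, x ^ 2 ∂π = fOpt π v u ^ 2 := by
    rw [integral_congr_ae (g := fun _ => fOpt π v u ^ 2) (hx.mono fun x hx => by simp [hx])]
    simp
  rw [h1] at e1
  rw [h2, ← e1] at e2
  norm_num at e2

lemma continuousAt_scalarMMSE (hπ : MemLp id 2 π) (hv : 0 < v) :
    ContinuousAt (scalarMMSE π) v := by
  have hpos : ∀ᶠ y in 𝓝 v, v / 2 < y ∧ y < 2 * v :=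
    (lt_mem_nhds (by linarith)).and (gt_mem_nhds (by linarith))
  have h : ContinuousAt (fun v => ∫ u, (√(2 * Real.pi * v))⁻¹ * postVar π v u) v := by
    -- On the window `(v / 2, 2 * v)` the prefactor is largest at the lower end, the second moment
    -- at the upper end.
    refine tendsto_integral_filter_of_dominated_convergence
      (fun u => (√(2 * Real.pi * (v / 2)))⁻¹ * postMoment π 2 (2 * v) u) ?_ ?_
      ((integrable_postMoment_two hπ (by positivity)).const_mul _) (ae_of_all _ fun u => ?_)
    · filter_upwards [hpos] with y hy
      exact ((integrable_postVar hπ (by linarith [hy.1])).const_mul _).aestronglyMeasurable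
    · filter_upwards [hpos] with y hy
      have hy0 : 0 < y := by linarith [hy.1]
      refine ae_of_all _ fun u => ?_
      rw [Real.norm_of_nonneg (mul_nonneg (by positivity) (postVar_nonneg _ _ _))]
      have := (postVar_le_postMoment hπ hy0 u).trans (postMoment_two_mono hπ hy0 hy.2.le u)
      have h0 := postVar_nonneg π y u
      gcongr
      exact hy.1.le
    · have : √(2 * Real.pi * v) ≠ 0 := by positivity
      exact ContinuousAt.mul (by fun_prop (disch := assumption)) (continuousAt_postVar hπ hv u)
  refine h.congr ?_
  filter_upwards [lt_mem_nhds hv] with y hy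
  exact (scalarMMSE_eq hπ hy).symm

end

/-! ### Limits of discounted double sums -/

lemma exists_prod_Ico_le {ξ : ℕ → ℝ} {w r : ℝ} (hξ : Tendsto ξ atTop (𝓝 w)) (hw : 0 ≤ w)
    (hr : w < r) : ∃ C, 0 ≤ C ∧ ∀ m t, m ≤ t → |∏ k ∈ Finset.Ico m t, ξ k| ≤ C * r ^ (t - m) := by
  have hr0 : 0 < r := hw.trans_lt hr
  have hev : ∀ᶠ k in atTop, |ξ k| < r :=
    hξ.abs.eventually (gt_mem_nhds (by rwa [abs_of_nonneg hw]))
  obtain ⟨N, hN⟩ := eventually_atTop.1 hev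
  obtain ⟨M, hM⟩ := hξ.abs.bddAbove_range
  have hM' : ∀ k, |ξ k| ≤ M := fun k => hM ⟨k, rfl⟩
  -- Only factors with index below `N` can exceed `r`, each by a ratio of at most `D`; so `D ^ N` is
  -- a constant independent of `m` and `t`.
  set D := max 1 (M / r)
  have hD1 : 1 ≤ D := le_max_left _ _
  have hD : ∀ k, |ξ k| ≤ D * r := fun k =>
    (hM' k).trans ((div_le_iff₀ hr0).1 (le_max_right _ _))
  have key : ∀ m t, m ≤ t → |∏ k ∈ Finset.Ico m t, ξ k| ≤ D ^ (min t N) * r ^ (t - m) := by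
    intro m t hmt
    induction t, hmt using Nat.le_induction with
    | base => simpa using one_le_pow₀ hD1
    | succ t hmt ih =>
      rw [Finset.prod_Ico_succ_top hmt, abs_mul, Nat.sub_add_comm hmt, pow_succ r]
      rcases lt_or_ge t N with h | h
      · rw [min_eq_left (by omega : t + 1 ≤ N), pow_succ]
        rw [min_eq_left h.le] at ih
        calc _ ≤ (D ^ t * r ^ (t - m)) * (D * r) := by gcongr; exact hD t
          _ = _ := by ring
      · rw [min_eq_right (by omega : N ≤ t + 1)]
        rw [min_eq_right h] at ih
        calc _ ≤ (D ^ N * r ^ (t - m)) * r := by gcongr; exact (hN t h).le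
          _ = _ := by ring
  refine ⟨D ^ N, by positivity, fun m t hmt => (key m t hmt).trans ?_⟩
  gcongr
  exact min_le_right _ _

lemma tendsto_prod_Ico_sub {ξ : ℕ → ℝ} {w : ℝ} (hξ : Tendsto ξ atTop (𝓝 w)) (τ : ℕ) :
    Tendsto (fun t => ∏ k ∈ Finset.Ico (t - τ) t, ξ k) atTop (𝓝 (w ^ τ)) := by
  have h : Tendsto (fun t => ∏ i ∈ Finset.range τ, ξ (t - τ + i)) atTop
      (𝓝 (∏ _i ∈ Finset.range τ, w)) :=
    tendsto_finsetProd _ fun i _ =>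
      hξ.comp ((tendsto_add_atTop_nat i).comp (tendsto_sub_atTop_nat τ))
  rw [Finset.prod_const, Finset.card_range] at h
  refine h.congr' ?_
  filter_upwards [eventually_ge_atTop τ] with t ht
  rw [Finset.prod_Ico_eq_prod_range, Nat.sub_sub_self ht]

/-- Discounted double sums of a convergent array converge to the double series at the limiting
discount factor. -/
lemma tendsto_discounted_sum {ξ : ℕ → ℝ} {c b : ℕ → ℕ → ℝ} {w r β B S T : ℝ}
    (hξ : Tendsto ξ atTop (𝓝 w)) (hw : 0 ≤ w) (hr : w < r)
    (hS : HasGen₂ c w S) (hT : HasGen₂ c r T)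
    (hb : Tendsto (fun n : ℕ × ℕ => b n.1 n.2) atTop (𝓝 β)) (hB : ∀ i j, |b i j| ≤ B) :
    Tendsto (fun n : ℕ × ℕ => ∑ τ' ∈ Finset.range (n.1 + 1), ∑ τ ∈ Finset.range (n.2 + 1),
      (∏ k ∈ Finset.Ico (n.1 - τ') n.1, ξ k) * (∏ k ∈ Finset.Ico (n.2 - τ) n.2, ξ k) *
        (c τ' τ * b (n.1 - τ') (n.2 - τ))) atTop (𝓝 (S * β)) := by
  have hr0 : 0 < r := hw.trans_lt hr
  obtain ⟨C, hC0, hC⟩ := exists_prod_Ico_le hξ hw hr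
  have hB0 : 0 ≤ B := (abs_nonneg _).trans (hB 0 0)
  -- Extended by zero, the finite sums become series over a fixed index set, and dominated
  -- convergence applies. The slack `w < r` is spent on the majorant: the products are only bounded
  -- by powers of `r`, not of `w`.
  let f : ℕ × ℕ → ℕ × ℕ → ℝ := fun n τ => if τ.1 ≤ n.1 ∧ τ.2 ≤ n.2 then
    (∏ k ∈ Finset.Ico (n.1 - τ.1) n.1, ξ k) * (∏ k ∈ Finset.Ico (n.2 - τ.2) n.2, ξ k) *
        (c τ.1 τ.2 * b (n.1 - τ.1) (n.2 - τ.2)) else 0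
  have hf : ∀ n : ℕ × ℕ, ∑' τ, f n τ = ∑ τ' ∈ Finset.range (n.1 + 1),
      ∑ τ ∈ Finset.range (n.2 + 1),
      (∏ k ∈ Finset.Ico (n.1 - τ') n.1, ξ k) * (∏ k ∈ Finset.Ico (n.2 - τ) n.2, ξ k) *
        (c τ' τ * b (n.1 - τ') (n.2 - τ)) := by
    intro n
    rw [tsum_eq_sum (s := Finset.range (n.1 + 1) ×ˢ Finset.range (n.2 + 1)), Finset.sum_product]
    · refine Finset.sum_congr rfl fun i hi => Finset.sum_congr rfl fun j hj => ?_
      rw [Finset.mem_range] at hi hj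
      exact if_pos ⟨by simp only; omega, by simp only; omega⟩
    · intro τ hτ
      refine if_neg fun h => hτ ?_
      simp only [Finset.mem_product, Finset.mem_range]
      omega
  simp only [← hf]
  have hlim : ∑' τ : ℕ × ℕ, c τ.1 τ.2 * w ^ (τ.1 + τ.2) * β = S * β :=
    (HasSum.mul_right β hS).tsum_eq
  rw [← hlim]
  have hsum : Summable fun n : ℕ × ℕ => |c n.1 n.2 * r ^ (n.1 + n.2)| :=
    (HasSum.summable hT).abs
  refine tendsto_tsum_of_dominated_convergence
    (bound := fun n => C * C * B * |c n.1 n.2 * r ^ (n.1 + n.2)|)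
    (hsum.mul_left _) (fun τ => ?_) (Eventually.of_forall fun n τ => ?_)
  · have h1 : Tendsto (fun n : ℕ × ℕ => n.1) atTop atTop := by
      rw [← prod_atTop_atTop_eq]; exact tendsto_fst
    have h2 : Tendsto (fun n : ℕ × ℕ => n.2) atTop atTop := by
      rw [← prod_atTop_atTop_eq]; exact tendsto_snd
    have hsub : Tendsto (fun n : ℕ × ℕ => (n.1 - τ.1, n.2 - τ.2)) atTop atTop := by
      nth_rewrite 2 [← prod_atTop_atTop_eq]
      exact ((tendsto_sub_atTop_nat _).comp h1).prodMk ((tendsto_sub_atTop_nat _).comp h2)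
    have h3 := (((tendsto_prod_Ico_sub hξ τ.1).comp h1).mul
      ((tendsto_prod_Ico_sub hξ τ.2).comp h2)).mul ((hb.comp hsub).const_mul (c τ.1 τ.2))
    have e : c τ.1 τ.2 * w ^ (τ.1 + τ.2) * β = w ^ τ.1 * w ^ τ.2 * (c τ.1 τ.2 * β) := by
      rw [pow_add]; ring
    rw [e]
    refine h3.congr' ?_
    filter_upwards [h1.eventually_ge_atTop τ.1, h2.eventually_ge_atTop τ.2] with n hn1 hn2
    exact (if_pos ⟨hn1, hn2⟩).symm
  · by_cases h : τ.1 ≤ n.1 ∧ τ.2 ≤ n.2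
    · have e1 := hC (n.1 - τ.1) n.1 (Nat.sub_le _ _)
      have e2 := hC (n.2 - τ.2) n.2 (Nat.sub_le _ _)
      rw [Nat.sub_sub_self h.1] at e1
      rw [Nat.sub_sub_self h.2] at e2
      simp only [f, if_pos h, Real.norm_eq_abs, abs_mul, abs_pow, abs_of_pos hr0]
      calc _ ≤ (C * r ^ τ.1) * (C * r ^ τ.2) * (|c τ.1 τ.2| * B) := by
            gcongr; exact hB _ _
        _ = _ := by rw [pow_add]; ring
    · simp only [f, if_neg h, norm_zero]
      positivity

/-- A Gram matrix with convergent diagonal is bounded. -/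
lemma exists_bound_of_gram {Ω : Type*} [MeasurableSpace Ω] {P : Measure Ω} {e : ℕ → Ω → ℝ}
    {d : ℕ → ℕ → ℝ} {L : ℝ} (he : ∀ n, MemLp (e n) 2 P)
    (hd : ∀ i j, d i j = ∫ ω, e i ω * e j ω ∂P) (hL : Tendsto (fun n => d n n) atTop (𝓝 L)) :
    ∃ B, ∀ i j, |d i j| ≤ B := by
  obtain ⟨B, hB⟩ := hL.bddAbove_range
  have hB' : ∀ n, ∫ ω, e n ω ^ 2 ∂P ≤ B := fun n => by
    simpa only [hd, ← pow_two] using hB ⟨n, rfl⟩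
  refine ⟨B, fun i j => ?_⟩
  have ii := (he i).integrable_sq
  have ij := (he j).integrable_sq
  calc |d i j| ≤ ∫ ω, |e i ω * e j ω| ∂P := by rw [hd]; exact abs_integral_le_integral_abs
    _ ≤ ∫ ω, (e i ω ^ 2 + e j ω ^ 2) / 2 ∂P := by
        refine integral_mono ((he i).integrable_mul (he j)).abs ((ii.add ij).div_const 2)
          fun ω => ?_
        simp only [abs_mul]
        nlinarith [sq_nonneg (|e i ω| - |e j ω|), sq_abs (e i ω), sq_abs (e j ω)]
    _ = ((∫ ω, e i ω ^ 2 ∂P) + ∫ ω, e j ω ^ 2 ∂P) / 2 := by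
        rw [integral_div, integral_add ii ij]
    _ ≤ B := by linarith [hB' i, hB' j]

/-! ### The Stieltjes and R-transforms -/

section
variable {ρ : Measure ℝ} [IsProbabilityMeasure ρ]

lemma integrable_stieltjes_of_lt (hρ : IsCompact ρ.support) {s : ℝ}
    (hs : ∀ l ∈ ρ.support, s < l) : Integrable (fun l => 1 / (l - s)) ρ := by
  obtain ⟨m, hm, hmin⟩ := hρ.exists_isLeast
    (Measure.nonempty_support (IsProbabilityMeasure.ne_zero ρ))
  have hms : 0 < m - s := sub_pos.2 (hs m hm)
  refine (integrable_const (1 / (m - s))).mono'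
    ((measurable_id.sub_const s).const_div 1).aestronglyMeasurable ?_
  filter_upwards [Measure.support_mem_ae] with l hl
  have h1 : m - s ≤ l - s := by linarith [hmin hl]
  rw [Real.norm_of_nonneg (by have := hms.trans_le h1; positivity)]
  gcongr

/-- The integrand is strictly increasing in `s` at every point of the support, and equal integrals
would force almost sure equality. -/
lemma stieltjes_lt_stieltjes (hρ : IsCompact ρ.support) {s t : ℝ}
    (ht : ∀ l ∈ ρ.support, t < l) (hst : s < t) : stieltjes ρ s < stieltjes ρ t := by
  have hs : ∀ l ∈ ρ.support, s < l := fun l hl => hst.trans (ht l hl)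
  have is := integrable_stieltjes_of_lt hρ hs
  have it := integrable_stieltjes_of_lt hρ ht
  have hlt : ∀ᵐ l ∂ρ, 1 / (l - s) < 1 / (l - t) := by
    filter_upwards [Measure.support_mem_ae] with l hl
    have := ht l hl
    exact one_div_lt_one_div_of_lt (by linarith) (by linarith)
  refine (integral_mono_ae is it (hlt.mono fun l hl => hl.le)).lt_of_ne fun h => ?_
  rw [integral_eq_iff_of_ae_le is it (hlt.mono fun l hl => hl.le)] at h
  obtain ⟨l, h1, h2⟩ := (hlt.and h).exists
  exact h1.ne h2

/-- Below the support, the Stieltjes transform is inverted by the inverse defining `R`. -/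
lemma invFunOn_stieltjes (hρ : IsCompact ρ.support) {s : ℝ} (hs : ∀ l ∈ ρ.support, s < l)
    (hpos : 0 < stieltjes ρ s) :
    Function.invFunOn (stieltjes ρ) (outside ρ) (stieltjes ρ s) = s := by
  have hex : ∃ a ∈ outside ρ, stieltjes ρ a = stieltjes ρ s := ⟨s, Or.inl hs, rfl⟩
  have hmem := Function.invFunOn_mem hex
  have heq := Function.invFunOn_eq hex
  set y := Function.invFunOn (stieltjes ρ) (outside ρ) (stieltjes ρ s)
  rcases hmem with hy | hy
  · rcases lt_trichotomy y s with h | h | h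
    · exact absurd heq (stieltjes_lt_stieltjes hρ hs h).ne
    · exact h
    · exact absurd heq (stieltjes_lt_stieltjes hρ hy h).ne'
  -- Above the support the transform is nonpositive, so a positive value has no preimage on that
  -- side.
  · have : stieltjes ρ y ≤ 0 := by
      refine integral_nonpos_of_ae ?_
      filter_upwards [Measure.support_mem_ae] with l hl
      have := hy l hl
      exact one_div_nonpos.2 (by linarith)
    linarith

/-- A value `η(x) = y` of the `η`-transform with `x, y > 0` determines the R-transform
at `-xy`. -/
lemma rTransform_of_etaTransform (hρ : IsCompact ρ.support) (hρ_nonneg : ρ.support ⊆ Set.Ici 0)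
    {x y : ℝ} (hx : 0 < x) (hy : 0 < y) (h : etaTransform ρ x = y) :
    -(x * y) ∈ rDomain ρ ∧ rTransform ρ (-(x * y)) = (1 - y) / (x * y) := by
  have hs : ∀ l ∈ ρ.support, -(1 / x) < l := fun l hl =>
    (neg_neg_of_pos (by positivity)).trans_le (hρ_nonneg hl)
  -- Since `1 / (l + 1 / x) = x / (1 + x * l)`, the point `-(1 / x)` is the preimage of `x * y`, and
  -- `R(-xy) = -1/x + 1/(xy)`.
  have hS : stieltjes ρ (-(1 / x)) = x * y := by
    rw [← h, stieltjes, etaTransform, ← integral_const_mul]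
    refine integral_congr_ae ?_
    filter_upwards [Measure.support_mem_ae] with l hl
    have h0 : 0 ≤ l := hρ_nonneg hl
    have h1 : 1 + x * l ≠ 0 := by positivity
    have h2 : l + 1 / x ≠ 0 := by positivity
    rw [sub_neg_eq_add]
    field_simp
    ring
  have hxy : x * y ≠ 0 := by positivity
  refine ⟨⟨-(1 / x), Or.inl hs, by rw [hS, neg_neg]⟩, ?_⟩
  rw [rTransform, if_neg (neg_ne_zero.2 hxy), neg_neg]
  have := invFunOn_stieltjes hρ hs (by rw [hS]; positivity)
  rw [hS] at this
  rw [this]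
  field_simp
  ring

end

/-! ### The state evolution -/

namespace IsBayesSE

variable {Ω : Type*} [MeasurableSpace Ω] {P : Measure Ω} {x₁ : Ω → ℝ}
  {z : ℕ → Ω → ℝ} {σ : ℝ} {p q θ : ℕ → ℝ} {a d : ℕ → ℕ → ℝ}

lemma diag_nonneg (h : IsBayesSE P x₁ z σ p q θ a d) (t : ℕ) : 0 ≤ a t t := by
  rw [← h.cov_eq]
  exact integral_nonneg fun ω => mul_self_nonneg _

/-- Signal and noise at time `t` follow the law of the Gaussian channel with variance `a t t`. -/
lemma map_prodMk [IsProbabilityMeasure P]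
    (h : IsBayesSE P x₁ z σ p q θ a d) (hx : AEMeasurable x₁ P) (t : ℕ) :
    P.map (fun ω => (x₁ ω, z t ω)) = (P.map x₁).prod (gaussianReal 0 (a t t).toNNReal) := by
  have hz := h.gaussian.aemeasurable t
  have hi : IndepFun x₁ (z t) P := h.indep.comp measurable_id (measurable_pi_apply t)
  have hvar : Var[z t; P] = a t t := by
    rw [variance_of_integral_eq_zero hz (h.mean_eq_zero t), ← h.cov_eq]
    simp only [pow_two]
  rw [(indepFun_iff_map_prod_eq_prod_map_map hx hz).1 hi,
    (h.gaussian.hasGaussianLaw_eval t).map_eq_gaussianReal, h.mean_eq_zero t, hvar]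

lemma integral_comp [IsProbabilityMeasure P]
    (h : IsBayesSE P x₁ z σ p q θ a d) (hx : AEMeasurable x₁ P) (t : ℕ)
    {F : ℝ × ℝ → ℝ} (hF : Measurable F) :
    ∫ ω, F (x₁ ω, z t ω) ∂P
      = ∫ xz, F xz ∂((P.map x₁).prod (gaussianReal 0 (a t t).toNNReal)) := by
  rw [← h.map_prodMk hx]
  exact (integral_map (hx.prodMk (h.gaussian.aemeasurable t)) hF.aestronglyMeasurable).symm

lemma memLp_map (hx : MemLp x₁ 2 P) : MemLp id 2 (P.map x₁) :=
  (memLp_map_measure_iff aestronglyMeasurable_id hx.aemeasurable).2 hx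

lemma memLp_error [IsProbabilityMeasure P]
    (h : IsBayesSE P x₁ z σ p q θ a d) (hx : MemLp x₁ 2 P) (t : ℕ) :
    MemLp (fun ω => fOpt (P.map x₁) (a t t) (x₁ ω + z t ω) - x₁ ω) 2 P := by
  have := Measure.isProbabilityMeasure_map hx.aemeasurable
  have hF := memLp_fOpt_sub (memLp_map hx) (h.diag_nonneg t)
  rw [← h.map_prodMk hx.aemeasurable] at hF
  exact hF.comp_of_map (hx.aemeasurable.prodMk (h.gaussian.aemeasurable t))

lemma d_diag_succ [IsProbabilityMeasure P]
    (h : IsBayesSE P x₁ z σ p q θ a d) (hx : MemLp x₁ 2 P) (t : ℕ) :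
    d (t + 1) (t + 1) = scalarMMSE (P.map x₁) (a t t) := by
  have := Measure.isProbabilityMeasure_map hx.aemeasurable
  have hm := measurable_fOpt (memLp_map hx) (h.diag_nonneg t)
  rw [h.d_succ_succ]
  simp only [← pow_two]
  exact h.integral_comp hx.aemeasurable t
    (F := fun p => (fOpt (P.map x₁) (a t t) (p.1 + p.2) - p.1) ^ 2) (by fun_prop)

lemma slope_eq [IsProbabilityMeasure P]
    (h : IsBayesSE P x₁ z σ p q θ a d) (hx : MemLp x₁ 2 P) {t : ℕ}
    (ht : 0 < a t t) :
    ∫ ω, deriv (fOpt (P.map x₁) (a t t)) (x₁ ω + z t ω) ∂P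
      = scalarMMSE (P.map x₁) (a t t) / a t t := by
  have := Measure.isProbabilityMeasure_map hx.aemeasurable
  rw [← integral_deriv_fOpt (memLp_map hx) ht]
  exact h.integral_comp hx.aemeasurable t
    (F := fun p => deriv (fOpt (P.map x₁) (a t t)) (p.1 + p.2))
    ((measurable_deriv _).comp (by fun_prop))

lemma exists_bound_a (h : IsBayesSE P x₁ z σ p q θ a d) {aₛ : ℝ}
    (ha : Tendsto (fun n : ℕ × ℕ => a n.1 n.2) atTop (𝓝 aₛ)) : ∃ B, ∀ i j, |a i j| ≤ B :=
  exists_bound_of_gram (fun n => (h.gaussian.hasGaussianLaw_eval n).memLp_two)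
    (fun i j => (h.cov_eq i j).symm) (ha.comp tendsto_atTop_diagonal)

lemma exists_bound_d [IsProbabilityMeasure P]
    (h : IsBayesSE P x₁ z σ p q θ a d) (hx : MemLp x₁ 2 P)
    (hx2 : ∫ ω, x₁ ω ^ 2 ∂P = 1) {dₛ : ℝ}
    (hd : Tendsto (fun n : ℕ × ℕ => d n.1 n.2) atTop (𝓝 dₛ)) : ∃ B, ∀ i j, |d i j| ≤ B := by
  -- Starting from the zero estimate, whose error is `-x₁`, makes all of `d`, including row and
  -- column `0`, a Gram matrix.
  let e : ℕ → Ω → ℝ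
    | 0 => fun ω => -x₁ ω
    | t + 1 => fun ω => fOpt (P.map x₁) (a t t) (x₁ ω + z t ω) - x₁ ω
  refine exists_bound_of_gram (e := e) (P := P) (fun n => ?_) (fun i j => ?_)
    (hd.comp tendsto_atTop_diagonal)
  · rcases n with _ | n
    · exact hx.neg
    · exact h.memLp_error hx n
  · rcases i with _ | i <;> rcases j with _ | j
    · simp only [e, ← pow_two, neg_sq, hx2, h.d_zero_zero]
    · simp only [e, neg_mul, integral_neg, h.d_zero_succ]
    · rw [h.d_succ_zero, h.d_zero_succ, ← integral_neg]
      refine integral_congr_ae (ae_of_all _ fun ω => ?_)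
      simp only [e]
      ring
    · exact h.d_succ_succ i j

/-- The mean square error at a fixed point of the state evolution. -/
lemma limit_d [IsProbabilityMeasure P]
    (h : IsBayesSE P x₁ z σ p q θ a d) (hx : MemLp x₁ 2 P) {aₛ dₛ : ℝ}
    (ha : Tendsto (fun n : ℕ × ℕ => a n.1 n.2) atTop (𝓝 aₛ))
    (hd : Tendsto (fun n : ℕ × ℕ => d n.1 n.2) atTop (𝓝 dₛ)) (haₛ : 0 < aₛ) :
    dₛ = scalarMMSE (P.map x₁) aₛ := by
  have := Measure.isProbabilityMeasure_map hx.aemeasurable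
  have h1 : Tendsto (fun t => d (t + 1) (t + 1)) atTop (𝓝 dₛ) :=
    (hd.comp tendsto_atTop_diagonal).comp (tendsto_add_atTop_nat 1)
  simp only [h.d_diag_succ hx] at h1
  exact tendsto_nhds_unique h1
    ((continuousAt_scalarMMSE (memLp_map hx) haₛ).tendsto.comp (ha.comp tendsto_atTop_diagonal))

lemma tendsto_slope [IsProbabilityMeasure P]
    (h : IsBayesSE P x₁ z σ p q θ a d) (hx : MemLp x₁ 2 P) {aₛ : ℝ}
    (ha : Tendsto (fun n : ℕ × ℕ => a n.1 n.2) atTop (𝓝 aₛ)) (haₛ : 0 < aₛ) :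
    Tendsto (fun k => ∫ ω, deriv (fOpt (P.map x₁) (a k k)) (x₁ ω + z k ω) ∂P) atTop
      (𝓝 (scalarMMSE (P.map x₁) aₛ / aₛ)) := by
  have := Measure.isProbabilityMeasure_map hx.aemeasurable
  have hdiag : Tendsto (fun t => a t t) atTop (𝓝 aₛ) := ha.comp tendsto_atTop_diagonal
  refine (((continuousAt_scalarMMSE (memLp_map hx) haₛ).tendsto.comp hdiag).div hdiag
    haₛ.ne').congr' ?_
  -- The slope identity needs positive variance, which the limit `aₛ > 0` guarantees only for late
  -- times.
  filter_upwards [hdiag.eventually (lt_mem_nhds haₛ)] with t ht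
  exact (h.slope_eq hx ht).symm

/-- The state evolution equation at a fixed point, in terms of generating functions. -/
lemma fixed_point [IsProbabilityMeasure P]
    (h : IsBayesSE P x₁ z σ p q θ a d) (hx : MemLp x₁ 2 P)
    (hx2 : ∫ ω, x₁ ω ^ 2 ∂P = 1) {aₛ dₛ w : ℝ}
    (ha : Tendsto (fun n : ℕ × ℕ => a n.1 n.2) atTop (𝓝 aₛ))
    (hd : Tendsto (fun n : ℕ × ℕ => d n.1 n.2) atTop (𝓝 dₛ)) (haₛ : 0 < aₛ)
    (hw : w = scalarMMSE (P.map x₁) aₛ / aₛ) (hw0 : 0 ≤ w)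
    (hp : ConvergesBeyond p w) (hq : ConvergesBeyond q w) (hθ : ConvergesBeyond θ w) :
    (gen p w * gen q w
      + (1 - w) * (gen p w * deriv (gen q) w - deriv (gen p) w * gen q w)
      + (2 * w - 1) * (gen p w * deriv (gen (conv q θ)) w
        - gen (conv q θ) w * deriv (gen p) w)) * aₛ
      - (gen p w * deriv (gen (conv q θ)) w - gen (conv q θ) w * deriv (gen p) w) * dₛ
      - gen q w * (gen q w * (gen θ w + w * deriv (gen θ) w - deriv (gen θ) w)) * σ ^ 2
      = 0 := by
  obtain ⟨R₁, h₁, hp'⟩ := hp.exists_between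
  obtain ⟨R₂, h₂, hq'⟩ := hq.exists_between
  obtain ⟨R₃, h₃, hθ'⟩ := hθ.exists_between
  -- One radius above `w` at which all three series still converge, as the domination in
  -- `tendsto_discounted_sum` requires.
  obtain ⟨r, hwr, hr⟩ := exists_between (lt_min h₁ (lt_min h₂ h₃))
  have hr0 : 0 ≤ r := hw0.trans hwr.le
  have hpr := hp' r (hr.trans_le (min_le_left _ _))
  have hqr := hq' r (hr.trans_le ((min_le_right _ _).trans (min_le_left _ _)))
  have hθr := hθ' r (hr.trans_le ((min_le_right _ _).trans (min_le_right _ _)))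
  obtain ⟨A, hA⟩ := h.exists_bound_a ha
  obtain ⟨D, hD⟩ := h.exists_bound_d hx hx2 hd
  have hξ := h.tendsto_slope hx ha haₛ
  rw [← hw] at hξ
  have la := tendsto_discounted_sum hξ hw0 hwr (hasGen₂_coeffA hw0 hp hq hθ)
    (hasGen₂_coeffA hr0 hpr hqr hθr) ha hA
  have ld := tendsto_discounted_sum hξ hw0 hwr (hasGen₂_coeffD hw0 hp hq hθ)
    (hasGen₂_coeffD hr0 hpr hqr hθr) hd hD
  have ln := tendsto_discounted_sum hξ hw0 hwr (hasGen₂_coeffNoise hw0 hq hθ)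
    (hasGen₂_coeffNoise hr0 hqr hθr) (b := fun _ _ => σ ^ 2) tendsto_const_nhds
    (fun _ _ => le_rfl)
  refine tendsto_nhds_unique ((la.sub ld).sub ln) ?_
  refine tendsto_const_nhds.congr fun n => ?_
  rw [← h.se n.1 n.2]
  simp only [← Finset.sum_sub_distrib]
  refine Finset.sum_congr rfl fun i _ => Finset.sum_congr rfl fun j _ => ?_
  ring

end IsBayesSE

end CAMP

theorem theorem5 {Ω : Type*} [MeasurableSpace Ω] (P : Measure Ω) [IsProbabilityMeasure P]
    -- the asymptotic eigenvalue distribution: compactly supported on `[0, ∞)`, unit first moment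
    (ρ : Measure ℝ) [IsProbabilityMeasure ρ] (hρ_compact : IsCompact ρ.support)
    (hρ_nonneg : ρ.support ⊆ Set.Ici 0) (hρ_mean : ∫ l, l ∂ρ = 1)
    -- the noise level
    (σ : ℝ) (hσ : 0 < σ)
    -- a signal element: zero mean and unit variance
    (x₁ : Ω → ℝ) (hx₁ : MemLp x₁ 2 P) (hx₁_mean : ∫ ω, x₁ ω ∂P = 0)
    (hx₁_var : ∫ ω, x₁ ω ^ 2 ∂P = 1)
    -- the tap coefficients, with `G = P/Q` as power series in `z⁻¹`
    (g θ p q : ℕ → ℝ) (hg : g 0 = 1) (hθ : θ 0 = 1) (hp : p 0 = 1) (hq : q 0 = 1)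
    (hpq : ∀ t, p t = CAMP.conv q g t)
    -- a solution of the state evolution that converges to `(aₛ, dₛ)`
    (z : ℕ → Ω → ℝ) (a d : ℕ → ℕ → ℝ) (hSE : CAMP.IsBayesSE P x₁ z σ p q θ a d)
    (aₛ dₛ : ℝ) (ha : Tendsto (fun n : ℕ × ℕ => a n.1 n.2) atTop (𝓝 aₛ))
    (hd : Tendsto (fun n : ℕ × ℕ => d n.1 n.2) atTop (𝓝 dₛ))
    (haₛ : 0 < aₛ) (ξₛ : ℝ) (hξₛ : ξₛ = dₛ / aₛ)
    -- `P`, `Q`, `Θ` converge around `z⁻¹ = ξₛ`, and `G = P/Q` is defined there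
    (hp_conv : CAMP.ConvergesBeyond p ξₛ) (hq_conv : CAMP.ConvergesBeyond q ξₛ)
    (hθ_conv : CAMP.ConvergesBeyond θ ξₛ) (hQ : CAMP.gen q ξₛ ≠ 0)
    -- the condition on the generating functions `G` and `Θ`
    (hGΘ : CAMP.ClosedForm ρ p q θ ξₛ)
    (hΘ : CAMP.gen θ ξₛ = 1)
    (hΘ' : 1 + (ξₛ - 1) * deriv (CAMP.gen θ) ξₛ ≠ 0) :
    -dₛ / σ ^ 2 ∈ CAMP.rDomain ρ ∧
      aₛ = σ ^ 2 / CAMP.rTransform ρ (-dₛ / σ ^ 2) ∧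
      dₛ = CAMP.scalarMMSE (P.map x₁) aₛ := by
  have := Measure.isProbabilityMeasure_map hx₁.aemeasurable (μ := P)
  have hπ := CAMP.IsBayesSE.memLp_map hx₁
  have hm1 : ∫ x, x ∂(P.map x₁) = 0 := by
    rw [integral_map hx₁.aemeasurable (by fun_prop), hx₁_mean]
  have hm2 : ∫ x, x ^ 2 ∂(P.map x₁) = 1 := by
    rw [integral_map hx₁.aemeasurable (by fun_prop), hx₁_var]
  have hd_eq := hSE.limit_d hx₁ ha hd haₛ
  have hd0 : 0 < dₛ := hd_eq ▸ CAMP.scalarMMSE_pos hπ hm1 hm2 haₛ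
  have hda : dₛ < aₛ := by
    have h1 := CAMP.scalarMMSE_le hπ hm1 hm2 haₛ
    rw [← hd_eq] at h1
    exact h1.trans_lt (div_lt_self haₛ (by linarith))
  have hw0 : 0 < ξₛ := by rw [hξₛ]; positivity
  have hw1 : ξₛ < 1 := by rw [hξₛ]; exact (div_lt_one haₛ).2 hda
  have hdw : dₛ = ξₛ * aₛ := by rw [hξₛ, div_mul_cancel₀ _ haₛ.ne']
  have hG : aₛ * CAMP.gen p ξₛ = σ ^ 2 * CAMP.gen q ξₛ := by
    have h := hSE.fixed_point hx₁ hx₁_var ha hd haₛ (by rw [hξₛ, hd_eq]) hw0.le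
      hp_conv hq_conv hθ_conv
    rw [CAMP.deriv_gen_conv hw0.le hq_conv hθ_conv,
      CAMP.gen_conv (hq_conv.summable hw0.le) (hθ_conv.summable hw0.le), hΘ, hdw] at h
    -- With `R = Q` and `R' = Q' + Q Θ'`, where `R` is the generating function of `conv q θ`, the
    -- terms in `P Q' - P' Q` have total weight `(1 - ξₛ) + (2 ξₛ - 1) - ξₛ = 0`; what remains has
    -- `Q (1 + (ξₛ - 1) Θ')` as a common factor.
    refine mul_left_cancel₀ (mul_ne_zero hQ hΘ') ?_
    linear_combination h
  have hP : CAMP.gen p ξₛ ≠ 0 := fun h0 => by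
    rw [h0, mul_zero] at hG
    exact mul_ne_zero (by positivity) hQ hG.symm
  have hPQ : CAMP.gen p ξₛ / CAMP.gen q ξₛ = σ ^ 2 / aₛ := by
    rw [div_eq_div_iff hQ haₛ.ne']
    linarith
  have h1w : 0 < 1 - ξₛ := sub_pos.2 hw1
  have harg : CAMP.tapArg p q θ ξₛ = dₛ / σ ^ 2 / (1 - ξₛ) := by
    rw [CAMP.tapArg, hΘ, hPQ, hdw]
    field_simp
    ring
  have harg0 : 0 < CAMP.tapArg p q θ ξₛ := by rw [harg]; positivity
  -- The argument is positive and the support nonnegative, so the `η`-transform is defined here and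
  -- the closed form applies at the endpoint `ξₛ`.
  have hη := hGΘ ξₛ ⟨hw0.le, le_rfl⟩ hQ (mul_ne_zero h1w.ne' (div_ne_zero hP hQ))
    fun l hl => by
      have : 0 ≤ l := hρ_nonneg hl
      positivity
  rw [hΘ, mul_one] at hη
  obtain ⟨hdom, hR⟩ := CAMP.rTransform_of_etaTransform hρ_compact hρ_nonneg harg0 h1w hη
  have hxy : -(CAMP.tapArg p q θ ξₛ * (1 - ξₛ)) = -dₛ / σ ^ 2 := by
    rw [harg, div_mul_cancel₀ _ h1w.ne', neg_div]
  rw [hxy] at hdom hR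
  refine ⟨hdom, ?_, hd_eq⟩
  rw [hR, harg, div_mul_cancel₀ _ h1w.ne', hdw, sub_sub_cancel]
  field_simp
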